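/- Let $n\ge 2$ and let $\gamma:\mathbb C^n\to\mathbb C^n$ be a holomorphic contraction fixing $0$, that is, a biholomorphism with $\gamma(0)=0$ whose iterates $\gamma^k$ converge to $0$ uniformly on compact subsets as $k\to\infty$. Let $X=(\mathbb C^n\setminus\{0\})/\langle\gamma\rangle$ be the associated Hopf manifold, with the complex structure that it inherits as a quotient. Then $$c_1^{BC}(X)\neq 0 .$$ Here $H^{1,1}_{BC}(X)$ is the space of $d$-closed smooth $(1,1)$-forms on $X$ modulo the forms $\partial\bar\partial f$ with $f\in C^\infty(X,\mathbb C)$, and $c_1^{BC}(X)\in H^{1,1}_{BC}(X)$ is the class of the Chern–Ricci form of any Hermitian metric $\omega$ on $X$, given in local holomorphic coordinates by $-\mathrm i\,\partial\bar\partial\log\det\omega$ (this class does not depend on $\omega$). -/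

import Mathlib

open scoped Manifold ContDiff Topology
open Complex

noncomputable section

/-! ### The operators `∂̄` and `∂∂̄` on functions, in a complex vector space -/

section LocalOperators

variable {E : Type*} [NormedAddCommGroup E] [NormedSpace ℂ E]

/-- Multiplication by `i`, as a real-linear endomorphism. -/
def mulByI (E : Type*) [NormedAddCommGroup E] [NormedSpace ℂ E] : E →L[ℝ] E :=
  (Complex.I • ContinuousLinearMap.id ℂ E).restrictScalars ℝ

/-- `∂̄u (v) = (du(v) + i du(iv)) / 2`, for a complex-valued function `u`. -/
def dbar (u : E → ℂ) (z : E) : E →L[ℝ] ℂ :=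
  (1 / 2 : ℂ) • (fderiv ℝ u z + Complex.I • (fderiv ℝ u z).comp (mulByI E))

/-- `∂̄u` as a differential 1-form. -/
def dbarForm (u : E → ℂ) (z : E) : E [⋀^Fin 1]→L[ℝ] ℂ :=
  ContinuousAlternatingMap.ofSubsingleton ℝ E ℂ (0 : Fin 1) (dbar u z)

/-- The complex 2-form `∂∂̄u`. Since `∂̄∂̄u = 0`, it is the exterior derivative of `∂̄u`. -/
def ddbar (u : E → ℂ) (z : E) : E [⋀^Fin 2]→L[ℝ] ℂ :=
  extDeriv (dbarForm u) z

theorem extDeriv_const_smul_complex {k : ℕ} (c : ℂ) {α : E → E [⋀^Fin k]→L[ℝ] ℂ} {z : E}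
    (hα : DifferentiableAt ℝ α z) : extDeriv (c • α) z = c • extDeriv α z := by
  ext v
  rw [extDeriv_apply (hα.const_smul c), ContinuousAlternatingMap.smul_apply, extDeriv_apply hα,
    Finset.smul_sum]
  refine Finset.sum_congr rfl fun i _ => ?_
  have h : DifferentiableAt ℝ (fun x => α x (i.removeNth v)) z :=
    (ContinuousAlternatingMap.apply ℝ E ℂ (i.removeNth v)).differentiableAt.comp z hα
  have h' : (fun x => (c • α) x (i.removeNth v)) = c • fun x => α x (i.removeNth v) := rfl
  rw [h', fderiv_const_smul h c, smul_comm c]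
  rfl

theorem dbarForm_differentiableAt {u : E → ℂ} {z : E} (hu : ContDiffAt ℝ ∞ u z) :
    DifferentiableAt ℝ (dbarForm u) z := by
  have h1 : DifferentiableAt ℝ (fderiv ℝ u) z :=
    (hu.fderiv_right (m := 1) (by norm_cast)).differentiableAt (by simp)
  have h2 : DifferentiableAt ℝ (dbar u) z := by
    have h3 : DifferentiableAt ℝ (fun w => (fderiv ℝ u w).comp (mulByI E)) z :=
      h1.clm_comp (differentiableAt_const _)
    exact (h1.add (h3.const_smul Complex.I)).const_smul (1 / 2 : ℂ)
  exact (ContinuousAlternatingMap.ofSubsingletonLIE (𝕜 := ℝ) (E := E) (F := ℂ)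
    (0 : Fin 1)).toContinuousLinearEquiv.differentiableAt.comp z h2

theorem ddbar_congr {u v : E → ℂ} {z : E} (h : u =ᶠ[𝓝 z] v) : ddbar u z = ddbar v z := by
  refine Filter.EventuallyEq.extDeriv_eq ?_
  filter_upwards [h.eventuallyEq_nhds] with w hw
  simp only [dbarForm, dbar, hw.fderiv_eq]

theorem ddbar_add {u v : E → ℂ} {z : E} (hu : ContDiffAt ℝ ∞ u z) (hv : ContDiffAt ℝ ∞ v z) :
    ddbar (u + v) z = ddbar u z + ddbar v z := by
  rw [ddbar, ddbar, ddbar,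
    ← extDeriv_add (dbarForm_differentiableAt hu) (dbarForm_differentiableAt hv)]
  refine Filter.EventuallyEq.extDeriv_eq ?_
  filter_upwards [(hu.of_le (m := 2) (by norm_cast)).eventually (by simp),
    (hv.of_le (m := 2) (by norm_cast)).eventually (by simp)] with w h1 h2
  ext x
  simp only [dbarForm, dbar, fderiv_add (h1.differentiableAt (by simp))
    (h2.differentiableAt (by simp)), Pi.add_apply, ContinuousAlternatingMap.add_apply,
    ContinuousAlternatingMap.ofSubsingleton_apply_apply, _root_.add_apply,
    _root_.smul_apply, ContinuousLinearMap.comp_apply, smul_eq_mul]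
  ring

theorem ddbar_const_smul (c : ℂ) {u : E → ℂ} {z : E} (hu : ContDiffAt ℝ ∞ u z) :
    ddbar (c • u) z = c • ddbar u z := by
  rw [ddbar, ddbar, ← extDeriv_const_smul_complex c (dbarForm_differentiableAt hu)]
  refine Filter.EventuallyEq.extDeriv_eq ?_
  filter_upwards [(hu.of_le (m := 2) (by norm_cast)).eventually (by simp)] with w h1
  ext x
  simp only [dbarForm, dbar, fderiv_const_smul (h1.differentiableAt (by simp)) c, Pi.smul_apply,
    ContinuousAlternatingMap.smul_apply, ContinuousAlternatingMap.ofSubsingleton_apply_apply,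
    _root_.add_apply, _root_.smul_apply,
    ContinuousLinearMap.comp_apply, smul_eq_mul]
  ring

end LocalOperators

/-! ### Forms, Bott–Chern cohomology and Hermitian metrics on a complex manifold -/

section Manifold

variable {E : Type*} [NormedAddCommGroup E] [NormedSpace ℂ E]

/-- Complex-valued real-multilinear alternating `k`-forms on a complex manifold, with no
regularity. -/
def RoughForm (E : Type*) [NormedAddCommGroup E] [NormedSpace ℂ E]
    (M : Type*) [TopologicalSpace M] [ChartedSpace E M] (k : ℕ) : Type _ :=
  ∀ x : M, (TangentSpace 𝓘(ℂ, E) x) [⋀^Fin k]→L[ℝ] ℂ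

variable {M : Type*} [TopologicalSpace M] [ChartedSpace E M]

instance (k : ℕ) : AddCommGroup (RoughForm E M k) :=
  inferInstanceAs (AddCommGroup (∀ x : M, (TangentSpace 𝓘(ℂ, E) x) [⋀^Fin k]→L[ℝ] ℂ))

instance (k : ℕ) : Module ℂ (RoughForm E M k) :=
  inferInstanceAs (Module ℂ (∀ x : M, (TangentSpace 𝓘(ℂ, E) x) [⋀^Fin k]→L[ℝ] ℂ))

/-- The derivative of the inverse of a chart. -/
def chartSymmDeriv (e : OpenPartialHomeomorph M E) (z : E) :
    E →L[ℂ] TangentSpace 𝓘(ℂ, E) (e.symm z) :=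
  mfderiv 𝓘(ℂ, E) 𝓘(ℂ, E) e.symm z

/-- The expression of a form in a chart `e`: its pull-back by `e⁻¹`. -/
def localForm {k : ℕ} (e : OpenPartialHomeomorph M E) (α : RoughForm E M k) (z : E) :
    E [⋀^Fin k]→L[ℝ] ℂ :=
  (α (e.symm z)).compContinuousLinearMap ((chartSymmDeriv e z).restrictScalars ℝ)

theorem localForm_add {k : ℕ} (e : OpenPartialHomeomorph M E) (α β : RoughForm E M k) :
    localForm e (α + β) = localForm e α + localForm e β := rfl

theorem localForm_smul {k : ℕ} (e : OpenPartialHomeomorph M E) (c : ℂ) (α : RoughForm E M k) :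
    localForm e (c • α) = c • localForm e α := rfl

/-- Smoothness of a form. -/
def IsSmoothForm {k : ℕ} (α : RoughForm E M k) : Prop :=
  ∀ e ∈ atlas E M, ContDiffOn ℝ ∞ (localForm e α) e.target

/-- A 2-form is of type `(1,1)` if and only if it is invariant under multiplication by `i`. -/
def IsOneOne (α : RoughForm E M 2) : Prop :=
  ∀ (x : M) (v w : TangentSpace 𝓘(ℂ, E) x),
    α x ![Complex.I • v, Complex.I • w] = α x ![v, w]

/-- `dα = 0`. -/
def IsClosedForm {k : ℕ} (α : RoughForm E M k) : Prop :=
  ∀ e ∈ atlas E M, ∀ z ∈ e.target, extDeriv (localForm e α) z = 0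

/-- Smoothness (in the real sense) of a complex-valued function. -/
def IsSmoothFun (f : M → ℂ) : Prop :=
  ∀ e ∈ atlas E M, ContDiffOn ℝ ∞ (f ∘ e.symm) e.target

/-- `α = ∂∂̄f` on `M`. -/
def IsDdbarOf (f : M → ℂ) (α : RoughForm E M 2) : Prop :=
  ∀ e ∈ atlas E M, ∀ z ∈ e.target, localForm e α z = ddbar (f ∘ e.symm) z

theorem IsSmoothForm.differentiableAt {k : ℕ} {α : RoughForm E M k} (h : IsSmoothForm α)
    {e : OpenPartialHomeomorph M E} (he : e ∈ atlas E M) {z : E} (hz : z ∈ e.target) :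
    DifferentiableAt ℝ (localForm e α) z :=
  ((h e he).contDiffAt (e.open_target.mem_nhds hz)).differentiableAt (by simp)

variable (E M) in
/-- The space of closed smooth complex `(1,1)`-forms. -/
def closedOneOne : Submodule ℂ (RoughForm E M 2) where
  carrier := {α | IsSmoothForm α ∧ IsOneOne α ∧ IsClosedForm α}
  zero_mem' := by
    have h0 : ∀ e : OpenPartialHomeomorph M E,
        localForm e (0 : RoughForm E M 2) = fun _ => 0 := fun e => rfl
    refine ⟨fun e _ => ?_, fun x v w => rfl, fun e _ z _ => ?_⟩
    · rw [h0]
      exact contDiffOn_const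
    · rw [h0, extDeriv, fderiv_fun_const]
      exact map_zero (ContinuousAlternatingMap.alternatizeUncurryFinCLM ℝ E ℂ)
  add_mem' := by
    rintro α β ⟨hα, hα', hα''⟩ ⟨hβ, hβ', hβ''⟩
    refine ⟨fun e he => (hα e he).add (hβ e he), fun x v w => ?_, fun e he z hz => ?_⟩
    · exact congrArg₂ (· + ·) (hα' x v w) (hβ' x v w)
    · rw [localForm_add, extDeriv_add (hα.differentiableAt he hz) (hβ.differentiableAt he hz),
        hα'' e he z hz, hβ'' e he z hz, add_zero]
  smul_mem' := by
    rintro c α ⟨hα, hα', hα''⟩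
    refine ⟨fun e he => (hα e he).const_smul c, fun x v w => ?_, fun e he z hz => ?_⟩
    · exact congrArg (c • ·) (hα' x v w)
    · rw [localForm_smul, extDeriv_const_smul_complex c (hα.differentiableAt he hz),
        hα'' e he z hz, smul_zero]

variable (E M) in
/-- The image of `∂∂̄ : C^∞(M, ℂ) → {closed (1,1)-forms}`. -/
def ddbarExact : Submodule ℂ (closedOneOne E M) where
  carrier := {α | ∃ f : M → ℂ, IsSmoothFun (E := E) f ∧ IsDdbarOf f α.1}
  zero_mem' := by
    refine ⟨fun _ => 0, fun e _ => contDiffOn_const, fun e _ z _ => ?_⟩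
    have h := ddbar_const_smul (0 : ℂ) (u := fun _ : E => (0 : ℂ)) (z := z) contDiffAt_const
    rw [zero_smul ℂ (ddbar _ z), zero_smul] at h
    exact h.symm
  add_mem' := by
    rintro α β ⟨f, hf, hα⟩ ⟨g, hg, hβ⟩
    refine ⟨f + g, fun e he => (hf e he).add (hg e he), fun e he z hz => ?_⟩
    have hz' := e.open_target.mem_nhds hz
    have h := ddbar_add ((hf e he).contDiffAt hz') ((hg e he).contDiffAt hz')
    rw [← hα e he z hz, ← hβ e he z hz] at h
    exact h.symm
  smul_mem' := by
    rintro c α ⟨f, hf, hα⟩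
    refine ⟨c • f, fun e he => (hf e he).const_smul c, fun e he z hz => ?_⟩
    have h := ddbar_const_smul c ((hf e he).contDiffAt (e.open_target.mem_nhds hz))
    rw [← hα e he z hz] at h
    exact h.symm

variable (E M) in
/-- The Bott–Chern cohomology group `H^{1,1}_{BC}(M)`: closed smooth complex `(1,1)`-forms modulo
the image of `∂∂̄`. -/
abbrev BottChernOneOne : Type _ := closedOneOne E M ⧸ ddbarExact E M

variable (E M) in
/-- A smooth Hermitian metric on a complex manifold, conjugate-linear in the first variable. -/
structure HermitianMetric where
  /-- The Hermitian inner product on each tangent space. -/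
  inner : ∀ x : M, TangentSpace 𝓘(ℂ, E) x →ₗ⋆[ℂ] TangentSpace 𝓘(ℂ, E) x →ₗ[ℂ] ℂ
  conj_symm : ∀ (x : M) (v w : TangentSpace 𝓘(ℂ, E) x),
    (starRingEnd ℂ) (inner x v w) = inner x w v
  pos : ∀ (x : M) (v : TangentSpace 𝓘(ℂ, E) x), v ≠ 0 → 0 < (inner x v v).re
  smooth : ∀ e ∈ atlas E M, ∀ v w : E,
    ContDiffOn ℝ ∞ (fun z => inner (e.symm z) (chartSymmDeriv e z v) (chartSymmDeriv e z w))
      e.target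

end Manifold

/-! ### The first Bott–Chern class -/

section ChernRicci

/-- The complex vector space `ℂⁿ`. -/
abbrev Cn (n : ℕ) : Type := EuclideanSpace ℂ (Fin n)

variable {n : ℕ} {M : Type*} [TopologicalSpace M] [ChartedSpace (Cn n) M]

/-- The Gram matrix of the metric in the coordinate frame of a chart. -/
def HermitianMetric.localMatrix (g : HermitianMetric (Cn n) M)
    (e : OpenPartialHomeomorph M (Cn n)) (z : Cn n) : Matrix (Fin n) (Fin n) ℂ :=
  Matrix.of fun j k => g.inner (e.symm z)
    (chartSymmDeriv e z (EuclideanSpace.single j 1)) (chartSymmDeriv e z (EuclideanSpace.single k 1))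

/-- `log det g` in a chart (the determinant is a positive real number). -/
def HermitianMetric.logDet (g : HermitianMetric (Cn n) M)
    (e : OpenPartialHomeomorph M (Cn n)) (z : Cn n) : ℝ :=
  Real.log (g.localMatrix e z).det.re

/-- `ρ` is the Chern–Ricci form of `g`: in every chart, `ρ = -i∂∂̄ log det g`. -/
def IsChernRicciForm (g : HermitianMetric (Cn n) M) (ρ : RoughForm (Cn n) M 2) : Prop :=
  ∀ e ∈ atlas (Cn n) M, ∀ z ∈ e.target,
    localForm e ρ z = (-Complex.I) • ddbar (fun w => (g.logDet e w : ℂ)) z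

section Gram

variable {V : Type*} [AddCommGroup V] [Module ℂ V]

/-- The Gram matrix of a sesquilinear form along a linear map out of `ℂⁿ`. -/
def gramMatrix (h : V →ₗ⋆[ℂ] V →ₗ[ℂ] ℂ) (L : Cn n →ₗ[ℂ] V) : Matrix (Fin n) (Fin n) ℂ :=
  Matrix.of fun j k => h (L (EuclideanSpace.single j 1)) (L (EuclideanSpace.single k 1))

theorem Cn.eq_sum (x : Cn n) : x = ∑ j, x j • (EuclideanSpace.single j (1 : ℂ) : Cn n) := by
  ext k
  simp [Finset.sum_apply, Pi.single_apply]

theorem gramMatrix_dotProduct (h : V →ₗ⋆[ℂ] V →ₗ[ℂ] ℂ) (L : Cn n →ₗ[ℂ] V) (x y : Cn n) :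
    h (L x) (L y) = ∑ j, ∑ k, (starRingEnd ℂ) (x j) * gramMatrix h L j k * y k := by
  conv_lhs => rw [Cn.eq_sum x, Cn.eq_sum y]
  simp only [map_sum, map_smul, map_smulₛₗ, LinearMap.sum_apply, LinearMap.smul_apply,
    smul_eq_mul, gramMatrix, Matrix.of_apply]
  rw [Finset.sum_comm]
  refine Finset.sum_congr rfl fun j _ => ?_
  rw [Finset.mul_sum]
  exact Finset.sum_congr rfl fun k _ => by ring

theorem gramMatrix_comp (L : Cn n →ₗ[ℂ] V) (B : Cn n →ₗ[ℂ] Cn n) :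
    ∃ P : Matrix (Fin n) (Fin n) ℂ, ∀ h : V →ₗ⋆[ℂ] V →ₗ[ℂ] ℂ,
      gramMatrix h (L ∘ₗ B) = P.conjTranspose * gramMatrix h L * P := by
  refine ⟨Matrix.of fun j k => B (EuclideanSpace.single k 1) j, fun h => ?_⟩
  ext a b
  have := gramMatrix_dotProduct h L (B (EuclideanSpace.single a 1)) (B (EuclideanSpace.single b 1))
  rw [Matrix.mul_assoc]
  simp only [Matrix.mul_apply, Matrix.conjTranspose_apply, Matrix.of_apply, Finset.mul_sum]
  simp only [mul_assoc] at this
  exact this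

open scoped ComplexOrder in
theorem gramMatrix_det_pos (h : V →ₗ⋆[ℂ] V →ₗ[ℂ] ℂ)
    (h1 : ∀ v w, (starRingEnd ℂ) (h v w) = h w v) (h2 : ∀ v, v ≠ 0 → 0 < (h v v).re)
    (L : Cn n →ₗ[ℂ] V) (hL : Function.Injective L) : 0 < (gramMatrix h L).det.re := by
  have hp : (gramMatrix h L).PosDef := by
    refine Matrix.PosDef.of_dotProduct_mulVec_pos ?_ fun x hx => ?_
    · ext a b
      exact h1 _ _
    · have h3 := gramMatrix_dotProduct h L (WithLp.toLp 2 x) (WithLp.toLp 2 x)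
      have h4 : star x ⬝ᵥ (gramMatrix h L).mulVec x =
          h (L (WithLp.toLp 2 x)) (L (WithLp.toLp 2 x)) := by
        rw [h3]
        simp only [dotProduct, Matrix.mulVec, Finset.mul_sum, Pi.star_apply, mul_assoc]
        rfl
      rw [h4, Complex.lt_def]
      have h5 : L (WithLp.toLp 2 x) ≠ 0 := by
        rw [Ne, ← map_zero L]
        intro h
        exact hx (by simpa using congrArg WithLp.ofLp (hL h))
      exact ⟨h2 _ h5, (Complex.conj_eq_iff_im.1 (h1 _ _)).symm⟩
  exact (Complex.lt_def.1 hp.det_pos).1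

end Gram

variable [IsManifold 𝓘(ℂ, Cn n) ω M]

theorem chartSymmDeriv_bijective {e : OpenPartialHomeomorph M (Cn n)} (he : e ∈ atlas (Cn n) M)
    {z : Cn n} (hz : z ∈ e.target) : Function.Bijective (chartSymmDeriv e z) :=
  have : IsManifold 𝓘(ℂ, Cn n) 1 M := .of_le (n := ω) (by simp)
  (mdifferentiable_of_mem_atlas (I := 𝓘(ℂ, Cn n)) he).symm.mfderiv_bijective hz

theorem HermitianMetric.det_pos (g : HermitianMetric (Cn n) M)
    {e : OpenPartialHomeomorph M (Cn n)} (he : e ∈ atlas (Cn n) M)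
    {z : Cn n} (hz : z ∈ e.target) : 0 < (g.localMatrix e z).det.re :=
  gramMatrix_det_pos (g.inner (e.symm z)) (g.conj_symm _) (g.pos _)
    (chartSymmDeriv e z).toLinearMap (chartSymmDeriv_bijective he hz).1

theorem HermitianMetric.logDet_contDiffAt (g : HermitianMetric (Cn n) M)
    {e : OpenPartialHomeomorph M (Cn n)} (he : e ∈ atlas (Cn n) M)
    {z : Cn n} (hz : z ∈ e.target) :
    ContDiffAt ℝ ∞ (fun w => (g.logDet e w : ℂ)) z := by
  refine Complex.ofRealCLM.contDiff.contDiffAt.comp z (ContDiffAt.log ?_ (g.det_pos he hz).ne')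
  refine Complex.reCLM.contDiff.contDiffAt.comp z ?_
  simp only [Matrix.det_apply]
  refine ContDiffAt.sum fun σ _ => ContDiffAt.const_smul _ (contDiffAt_prod fun j _ => ?_)
  exact (g.smooth e he _ _).contDiffAt (e.open_target.mem_nhds hz)

/-- The difference of the functions `log det` of two metrics does not depend on the chart. -/
theorem HermitianMetric.logDet_sub (g g' : HermitianMetric (Cn n) M)
    {e e' : OpenPartialHomeomorph M (Cn n)} (he : e ∈ atlas (Cn n) M) (he' : e' ∈ atlas (Cn n) M)
    {z z' : Cn n} (hz : z ∈ e.target) (hz' : z' ∈ e'.target) (h : e.symm z = e'.symm z') :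
    g.logDet e z - g'.logDet e z = g.logDet e' z' - g'.logDet e' z' := by
  obtain ⟨x, hx⟩ : ∃ x, x = e'.symm z' := ⟨_, rfl⟩
  -- both derivatives are regarded as maps to the tangent space at `x`
  let L : Cn n →ₗ[ℂ] TangentSpace 𝓘(ℂ, Cn n) x := (chartSymmDeriv e z).toLinearMap
  let L' : Cn n →ₗ[ℂ] TangentSpace 𝓘(ℂ, Cn n) x := (chartSymmDeriv e' z').toLinearMap
  have hL' : Function.Bijective L' := chartSymmDeriv_bijective he' hz'
  let B : Cn n →ₗ[ℂ] Cn n := (LinearEquiv.ofBijective L' hL').symm.toLinearMap ∘ₗ L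
  have hB : L' ∘ₗ B = L := by
    ext1 v
    exact (LinearEquiv.ofBijective L' hL').apply_symm_apply (L v)
  obtain ⟨P, hP⟩ := gramMatrix_comp L' B
  have key : ∀ g : HermitianMetric (Cn n) M,
      g.logDet e z = Real.log (Complex.normSq P.det) + g.logDet e' z' := by
    intro g
    have h1 : ∀ y, x = y → gramMatrix (g.inner y) (chartSymmDeriv e z).toLinearMap =
        gramMatrix (g.inner x) L := by
      rintro y rfl
      rfl
    have h2 : ∀ y, x = y → gramMatrix (g.inner y) (chartSymmDeriv e' z').toLinearMap =
        gramMatrix (g.inner x) L' := by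
      rintro y rfl
      rfl
    have h3 : g.localMatrix e z = gramMatrix (g.inner x) L := h1 _ (hx.trans h.symm)
    have h4 : g.localMatrix e' z' = gramMatrix (g.inner x) L' := h2 _ hx
    have h5 : (g.localMatrix e z).det.re =
        Complex.normSq P.det * (g.localMatrix e' z').det.re := by
      rw [h3, h4, ← hB, hP, Matrix.det_mul, Matrix.det_mul, Matrix.det_conjTranspose]
      have : star P.det * (gramMatrix (g.inner x) L').det * P.det =
          ((Complex.normSq P.det : ℝ) : ℂ) * (gramMatrix (g.inner x) L').det := by
        rw [Complex.normSq_eq_conj_mul_self]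
        simp only [Complex.star_def]
        ring
      rw [this, Complex.re_ofReal_mul]
    have h6 := g.det_pos he hz
    rw [h5] at h6
    rw [logDet, h5, Real.log_mul (left_ne_zero_of_mul h6.ne') (right_ne_zero_of_mul h6.ne')]
    rfl
  rw [key g, key g']
  ring

/-- The Chern–Ricci forms of two Hermitian metrics differ by an element of the image of `∂∂̄`. -/
theorem IsChernRicciForm.mk_eq_mk {g g' : HermitianMetric (Cn n) M}
    {ρ ρ' : closedOneOne (Cn n) M} (h : IsChernRicciForm g ρ.1) (h' : IsChernRicciForm g' ρ'.1) :
    (Submodule.Quotient.mk ρ : BottChernOneOne (Cn n) M) = Submodule.Quotient.mk ρ' := by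
  rw [Submodule.Quotient.eq]
  let u : M → ℂ := fun x =>
    (g.logDet (chartAt (Cn n) x) (chartAt (Cn n) x x) : ℂ) -
      g'.logDet (chartAt (Cn n) x) (chartAt (Cn n) x x)
  have hu : ∀ e ∈ atlas (Cn n) M, ∀ z ∈ e.target,
      (u ∘ e.symm) z = (g.logDet e z : ℂ) - g'.logDet e z := by
    intro e he z hz
    have := g.logDet_sub g' (chart_mem_atlas (Cn n) (e.symm z)) he
      (mem_chart_target (Cn n) (e.symm z)) hz
      ((chartAt (Cn n) (e.symm z)).left_inv (mem_chart_source (Cn n) (e.symm z)))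
    simp only [u, Function.comp_apply]
    exact_mod_cast this
  have hu' : ∀ e ∈ atlas (Cn n) M, ∀ z ∈ e.target, u ∘ e.symm =ᶠ[𝓝 z]
      (fun w => (g.logDet e w : ℂ)) + (-1 : ℂ) • fun w => (g'.logDet e w : ℂ) := by
    intro e he z hz
    filter_upwards [e.open_target.mem_nhds hz] with w hw
    rw [hu e he w hw]
    simp [sub_eq_add_neg]
  have hs : ∀ e ∈ atlas (Cn n) M, ∀ z ∈ e.target, ContDiffAt ℝ ∞ (u ∘ e.symm) z :=
    fun e he z hz => ((g.logDet_contDiffAt he hz).add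
      ((g'.logDet_contDiffAt he hz).const_smul (-1 : ℂ))).congr_of_eventuallyEq (hu' e he z hz)
  refine ⟨(-Complex.I) • u,
    fun e he z hz => ((hs e he z hz).const_smul (-Complex.I)).contDiffWithinAt,
    fun e he z hz => ?_⟩
  have h1 : ddbar (((-Complex.I) • u) ∘ e.symm) z = (-Complex.I) • ddbar (u ∘ e.symm) z :=
    ddbar_const_smul (-Complex.I) (hs e he z hz)
  rw [h1, ddbar_congr (hu' e he z hz), ddbar_add (v := (-1 : ℂ) • fun w => (g'.logDet e w : ℂ))
    (g.logDet_contDiffAt he hz) ((g'.logDet_contDiffAt he hz).const_smul (-1 : ℂ)),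
    ddbar_const_smul _ (g'.logDet_contDiffAt he hz), smul_add, smul_comm, ← h e he z hz,
    ← h' e he z hz]
  have h2 : (ρ - ρ').1 = ρ.1 + (-1 : ℂ) • ρ'.1 := by
    rw [neg_one_smul, ← sub_eq_add_neg]
    rfl
  rw [h2]
  rfl

open Classical in
/-- The first Bott–Chern class `c_1^{BC}(M)`: the class of the Chern–Ricci form of any Hermitian
metric on `M`. It does not depend on the metric, see `firstBottChernClass_eq`. (Every paracompact
complex manifold carries a Hermitian metric and every metric has a Chern–Ricci form; the value `0`
is only a default for spaces where this fails.) -/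
def firstBottChernClass (n : ℕ) (M : Type*) [TopologicalSpace M] [ChartedSpace (Cn n) M]
    [IsManifold 𝓘(ℂ, Cn n) ω M] : BottChernOneOne (Cn n) M :=
  if h : ∃ ρ : closedOneOne (Cn n) M, ∃ g : HermitianMetric (Cn n) M, IsChernRicciForm g ρ.1
  then Submodule.Quotient.mk h.choose else 0

/-- The first Bott–Chern class does not depend on the metric. -/
theorem firstBottChernClass_eq {g : HermitianMetric (Cn n) M} {ρ : closedOneOne (Cn n) M}
    (h : IsChernRicciForm g ρ.1) :
    firstBottChernClass n M = (Submodule.Quotient.mk ρ : BottChernOneOne (Cn n) M) := by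
  have h' : ∃ ρ : closedOneOne (Cn n) M, ∃ g : HermitianMetric (Cn n) M,
    IsChernRicciForm g ρ.1 := ⟨ρ, g, h⟩
  rw [firstBottChernClass, dif_pos h']
  exact h'.choose_spec.choose_spec.mk_eq_mk h

end ChernRicci

/-! ### Hopf manifolds -/

section Hopf

/-- A holomorphic contraction of `ℂⁿ` fixing the origin: a biholomorphism `γ` of `ℂⁿ` with
`γ(0) = 0` whose iterates converge to `0` uniformly on compact sets. (Over `ℂ`, `ContDiff ℂ ω` is
complex-analyticity, that is, holomorphy.) -/
structure HolomorphicContraction (n : ℕ) where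
  /-- The underlying bijection of `ℂⁿ`. -/
  toEquiv : Cn n ≃ Cn n
  holomorphic : ContDiff ℂ ω toEquiv
  holomorphic_symm : ContDiff ℂ ω toEquiv.symm
  map_zero : toEquiv 0 = 0
  contracting : ∀ K : Set (Cn n), IsCompact K → ∀ U ∈ 𝓝 (0 : Cn n),
    ∀ᶠ k : ℕ in Filter.atTop, Set.MapsTo (toEquiv^[k]) K U

/-- `ℂⁿ ∖ {0}`. -/
abbrev PuncturedCn (n : ℕ) : TopologicalSpace.Opens (Cn n) := ⟨{0}ᶜ, isOpen_compl_singleton⟩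

instance (n : ℕ) : LocallyCompactSpace (PuncturedCn n) :=
  (PuncturedCn n).isOpen.locallyCompactSpace

variable {n : ℕ} (γ : HolomorphicContraction n)

namespace HolomorphicContraction

theorem apply_ne_zero_iff (z : Cn n) : z ∈ PuncturedCn n ↔ γ.toEquiv z ∈ PuncturedCn n := by
  change z ≠ 0 ↔ γ.toEquiv z ≠ 0
  rw [Ne, Ne, ← γ.toEquiv.apply_eq_iff_eq, γ.map_zero]

/-- `γ` as a permutation of `ℂⁿ ∖ {0}`. -/
def perm : Equiv.Perm (PuncturedCn n) := γ.toEquiv.subtypeEquiv γ.apply_ne_zero_iff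

/-- The infinite cyclic group `⟨γ⟩` of transformations of `ℂⁿ ∖ {0}`. -/
abbrev group : Subgroup (Equiv.Perm (PuncturedCn n)) := Subgroup.zpowers γ.perm

theorem perm_pow_coe (k : ℕ) (z : PuncturedCn n) :
    (((γ.perm ^ k) z : PuncturedCn n) : Cn n) = γ.toEquiv^[k] z := by
  induction k with
  | zero => rfl
  | succ k ih =>
    rw [pow_succ', Equiv.Perm.mul_apply, Function.iterate_succ_apply', ← ih]
    rfl

/-- Every element of the group is the restriction of a holomorphic map of `ℂⁿ`. -/
theorem exists_holomorphic {g : Equiv.Perm (PuncturedCn n)} (hg : g ∈ γ.group) :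
    ∃ F : Cn n → Cn n, ContDiff ℂ ω F ∧ ∀ z : PuncturedCn n, (g z : Cn n) = F z := by
  obtain ⟨k, rfl⟩ := hg
  induction k using Int.induction_on with
  | zero => exact ⟨id, contDiff_id, fun _ => rfl⟩
  | succ i ih =>
    obtain ⟨F, hF, h⟩ := ih
    refine ⟨F ∘ γ.toEquiv, hF.comp γ.holomorphic, fun z => ?_⟩
    have h1 : (γ.perm ^ ((i : ℤ) + 1)) z = (γ.perm ^ (i : ℤ)) (γ.perm z) := by
      rw [zpow_add_one]
      rfl
    exact (congrArg Subtype.val h1).trans (h (γ.perm z))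
  | pred i ih =>
    obtain ⟨F, hF, h⟩ := ih
    refine ⟨F ∘ γ.toEquiv.symm, hF.comp γ.holomorphic_symm, fun z => ?_⟩
    have h1 : (γ.perm ^ (-(i : ℤ) - 1)) z = (γ.perm ^ (-(i : ℤ))) (γ.perm.symm z) := by
      rw [zpow_sub_one]
      rfl
    exact (congrArg Subtype.val h1).trans (h (γ.perm.symm z))

theorem eventually_disjoint {K L : Set (PuncturedCn n)} (hK : IsCompact K) (hL : IsCompact L) :
    ∀ᶠ k : ℕ in Filter.atTop, ∀ z ∈ K, (γ.perm ^ k) z ∉ L := by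
  have hL' : IsCompact ((↑) '' L : Set (Cn n)) := hL.image continuous_subtype_val
  have hU : ((↑) '' L : Set (Cn n))ᶜ ∈ 𝓝 (0 : Cn n) := by
    refine hL'.isClosed.isOpen_compl.mem_nhds ?_
    rintro ⟨w, -, hw⟩
    exact w.2 hw
  filter_upwards [γ.contracting _ (hK.image continuous_subtype_val) _ hU] with k hk z hz hzL
  refine hk ⟨z, hz, rfl⟩ ?_
  rw [← γ.perm_pow_coe]
  exact ⟨_, hzL, rfl⟩

instance : ContinuousConstSMul γ.group (PuncturedCn n) where
  continuous_const_smul g := by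
    obtain ⟨F, hF, h⟩ := γ.exists_holomorphic g.2
    refine Continuous.subtype_mk (f := fun z => (g.1 z : Cn n)) ?_ _
    simp only [h]
    exact hF.continuous.comp continuous_subtype_val

instance : ProperlyDiscontinuousSMul γ.group (PuncturedCn n) where
  finite_disjoint_inter_image {K L} hK hL := by
    obtain ⟨N, hN⟩ := Filter.eventually_atTop.1
      ((γ.eventually_disjoint hK hL).and (γ.eventually_disjoint hL hK))
    refine ((Set.finite_Ioo (-(N : ℤ)) N).image
      fun k : ℤ => (⟨γ.perm ^ k, k, rfl⟩ : γ.group)).subset ?_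
    rintro ⟨_, k, rfl⟩ ⟨_, ⟨z, hz, rfl⟩, hz'⟩
    have hz'' : (γ.perm ^ k) z ∈ L := hz'
    refine ⟨k, ⟨?_, ?_⟩, rfl⟩
    · by_contra hk
      obtain ⟨m, rfl⟩ : ∃ m : ℕ, k = -(m : ℤ) := ⟨k.natAbs, by lia⟩
      refine (hN m (by lia)).2 _ hz'' ?_
      rw [zpow_neg, zpow_natCast]
      have h1 : (γ.perm ^ m) ((γ.perm ^ m)⁻¹ z) = z := (γ.perm ^ m).apply_symm_apply z
      rwa [h1]
    · by_contra hk
      obtain ⟨m, rfl⟩ : ∃ m : ℕ, k = (m : ℤ) := ⟨k.natAbs, by lia⟩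
      exact (hN m (by lia)).1 z hz (by rwa [zpow_natCast] at hz'')

theorem zpow_apply_ne {k : ℤ} (hk : k ≠ 0) (z : PuncturedCn n) : (γ.perm ^ k) z ≠ z := by
  intro h
  have h1 : (γ.perm ^ k.natAbs) z = z := by
    rcases Int.natAbs_eq k with h2 | h2
    · rwa [h2, zpow_natCast] at h
    · rw [h2, zpow_neg, zpow_natCast, Equiv.Perm.inv_eq_iff_eq] at h
      exact h.symm
  have h2 : ∀ m : ℕ, (γ.perm ^ (k.natAbs * m)) z = z := by
    intro m
    induction m with
    | zero => rfl
    | succ m ih => rw [Nat.mul_succ, pow_add, Equiv.Perm.mul_apply, h1, ih]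
  obtain ⟨N, hN⟩ := Filter.eventually_atTop.1
    (γ.eventually_disjoint (isCompact_singleton (x := z)) (isCompact_singleton (x := z)))
  exact hN (k.natAbs * N) (Nat.le_mul_of_pos_left N (Int.natAbs_pos.2 hk)) z rfl (h2 N)

instance : IsCancelSMul γ.group (PuncturedCn n) where
  right_cancel' := by
    rintro ⟨_, k, rfl⟩ ⟨_, l, rfl⟩ z h
    have h' : (γ.perm ^ k) z = (γ.perm ^ l) z := h
    by_contra hkl
    have hkl' : -l + k ≠ 0 := by
      intro h0
      obtain rfl : k = l := by lia
      exact hkl rfl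
    refine γ.zpow_apply_ne hkl' z ?_
    rw [zpow_add, Equiv.Perm.mul_apply, h', zpow_neg]
    exact (γ.perm ^ l).symm_apply_apply z

end HolomorphicContraction

/-- The Hopf manifold `(ℂⁿ ∖ {0}) / ⟨γ⟩`, with the quotient topology and the charts given by the
local inverses of the quotient map. -/
abbrev HopfManifold : Type := MulAction.orbitRel.Quotient γ.group (PuncturedCn n)

theorem HopfManifold.transition_contDiffOn (a a' : PuncturedCn n)
    (σ σ' : OpenPartialHomeomorph (HopfManifold γ) (PuncturedCn n))
    (hσ : σ.symm = (Quotient.mk _ : PuncturedCn n → HopfManifold γ))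
    (hσ' : σ'.symm = (Quotient.mk _ : PuncturedCn n → HopfManifold γ)) :
    ContDiffOn ℂ ω
      ((σ.trans (chartAt (Cn n) a)).symm.trans (σ'.trans (chartAt (Cn n) a')))
      ((σ.trans (chartAt (Cn n) a)).symm.trans (σ'.trans (chartAt (Cn n) a'))).source := by
  intro z hz
  set c : OpenPartialHomeomorph (PuncturedCn n) (Cn n) := chartAt (Cn n) a with hc
  have hcz : ∀ y ∈ c.target, ((c.symm y : PuncturedCn n) : Cn n) = y :=
    fun y hy => c.right_inv hy
  have hz1 : z ∈ c.target := hz.1.1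
  have hz2 : σ.symm (c.symm z) ∈ σ'.source := hz.2.1
  obtain ⟨g, hg⟩ : ∃ g : γ.group, g • c.symm z = σ' (σ.symm (c.symm z)) := by
    have h1 : σ'.symm (σ' (σ.symm (c.symm z))) = σ.symm (c.symm z) := σ'.left_inv hz2
    rw [hσ', hσ] at h1
    rw [hσ]
    exact Quotient.exact h1
  obtain ⟨F, hF, hgF⟩ := γ.exists_holomorphic g.2
  have hcont : ContinuousAt (fun y => g • c.symm y) z :=
    (continuous_const_smul g).continuousAt.comp (c.continuousAt_symm hz1)
  have hev : ∀ᶠ y in 𝓝 z, g • c.symm y ∈ σ'.target := by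
    refine hcont.eventually_mem (σ'.open_target.mem_nhds ?_)
    rw [hg]
    exact σ'.map_source hz2
  refine (hF.contDiffAt.congr_of_eventuallyEq ?_).contDiffWithinAt
  filter_upwards [hev, c.open_target.mem_nhds hz1] with y hy hy'
  have h2 : σ.symm (c.symm y) = σ'.symm (g • c.symm y) := by
    rw [hσ, hσ']
    exact Quotient.sound (MulAction.orbitRel_apply.2 ⟨g⁻¹, inv_smul_smul g _⟩)
  change ((σ' (σ.symm (c.symm y)) : PuncturedCn n) : Cn n) = F y
  rw [h2, σ'.right_inv hy]
  exact (hgF (c.symm y)).trans (congrArg F (hcz y hy'))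

instance : IsManifold 𝓘(ℂ, Cn n) ω (HopfManifold γ) := by
  refine isManifold_of_contDiffOn _ _ _ ?_
  rintro _ _ ⟨q, rfl⟩ ⟨q', rfl⟩
  simp only [modelWithCornersSelf_coe, modelWithCornersSelf_coe_symm, Function.id_comp,
    Function.comp_id, Set.preimage_id, Set.range_id, Set.inter_univ]
  exact HopfManifold.transition_contDiffOn γ _ _ _ _
    (IsLocalHomeomorph.localInverseAt_symm _ _) (IsLocalHomeomorph.localInverseAt_symm _ _)

end Hopf

end

/-! Averaging a compactly supported multiple of the Euclidean metric over `⟨γ⟩` gives an invariant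
Hermitian metric on `ℂⁿ ∖ {0}`, hence a metric on the Hopf manifold. Let `u = logDetMetric` be the
logarithm of its determinant. Invariance yields the cocycle relation `u(z) = log |J_g(z)|² + u(g z)`
(`logDetMetric_eq`), where `J_g` is the Jacobian determinant. As `log |J_g|²` is pluriharmonic,
`-i∂∂̄u` is invariant and descends to the Chern–Ricci form `hopfRicci`.

If the class were zero, this form would be `∂∂̄f` for a smooth `f` on the quotient, and `u - i f`
would be pluriharmonic on `ℂⁿ ∖ {0}`. Two facts contradict each other.

Boundedness: since `n ≥ 2`, a point `z` near `0` lies on a complex line orthogonal to `z`, which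
misses the origin. The mean value property on the unit circle of that line bounds the function at
`z` by its maximum on a fixed compact shell (`exists_norm_le_of_pluriharmonic`).

Blow-up: along the orbit `γᵏ z → 0` the function `f` is constant, while Cauchy estimates force the
Jacobians of `γᵏ` at `z` to tend to `0`, so `u(γᵏ z) → +∞` (`tendsto_logDetMetric_iter`). -/

noncomputable section

/-! ### Calculus of `∂∂̄` and pluriharmonic functions. -/

section LocalDdbar

variable {E E' : Type*} [NormedAddCommGroup E] [NormedSpace ℂ E] [NormedAddCommGroup E']
  [NormedSpace ℂ E']

theorem dbar_apply (u : E → ℂ) (z v : E) :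
    dbar u z v = (1 / 2 : ℂ) * (fderiv ℝ u z v + Complex.I * fderiv ℝ u z (Complex.I • v)) := rfl

theorem dbarForm_apply (u : E → ℂ) (z : E) (v : Fin 1 → E) : dbarForm u z v = dbar u z (v 0) := rfl

theorem fderiv_real_eq_restrictScalars {F : E → E'} {z : E} (hF : DifferentiableAt ℂ F z) :
    fderiv ℝ F z = (fderiv ℂ F z).restrictScalars ℝ :=
  (hF.hasFDerivAt.restrictScalars ℝ).fderiv

/-- The differential of a holomorphic map is complex linear, so it commutes with `mulByI`. -/
theorem dbar_comp {u : E' → ℂ} {F : E → E'} {z : E} (hu : DifferentiableAt ℝ u (F z))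
    (hF : DifferentiableAt ℂ F z) :
    dbar (u ∘ F) z = (dbar u (F z)).comp (fderiv ℝ F z) := by
  ext v
  rw [dbar_apply, ContinuousLinearMap.comp_apply, dbar_apply,
    fderiv_comp z hu (hF.restrictScalars ℝ), fderiv_real_eq_restrictScalars hF]
  simp

/-- Holomorphic pull-back commutes with `∂̄` by `dbar_comp`, and the exterior derivative commutes
with every smooth pull-back. -/
theorem ddbar_comp {u : E' → ℂ} {F : E → E'} {z : E} (hu : ContDiffAt ℝ ∞ u (F z))
    (hF : ContDiffAt ℂ ω F z) :
    ddbar (u ∘ F) z = (ddbar u (F z)).compContinuousLinearMap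
      ((fderiv ℂ F z).restrictScalars ℝ) := by
  have hF' : DifferentiableAt ℂ F z := hF.differentiableAt (by simp)
  rw [ddbar, ddbar, ← fderiv_real_eq_restrictScalars hF',
    ← extDeriv_pullback (dbarForm_differentiableAt hu)
      ((hF.of_le (m := 2) (by simp)).restrict_scalars ℝ) (by simp)]
  refine Filter.EventuallyEq.extDeriv_eq ?_
  have h1 : ∀ᶠ w in 𝓝 z, ContDiffAt ℝ 1 u (F w) :=
    hF'.continuousAt.eventually ((hu.of_le (m := 1) (by norm_cast)).eventually (by simp))
  have h2 : ∀ᶠ w in 𝓝 z, ContDiffAt ℂ 1 F w := (hF.of_le (m := 1) (by simp)).eventually (by simp)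
  filter_upwards [h1, h2] with w h3 h4
  ext v
  rw [dbarForm_apply, dbar_comp (h3.differentiableAt (by simp)) (h4.differentiableAt (by simp))]
  rfl

theorem fderiv_dbarForm_apply {u : E → ℂ} {z : E} (hu : ContDiffAt ℝ ∞ u z) (v w : E) :
    fderiv ℝ (fun y => dbarForm u y (fun _ => w)) z v = (1 / 2 : ℂ) *
      (fderiv ℝ (fderiv ℝ u) z v w + Complex.I * fderiv ℝ (fderiv ℝ u) z v (Complex.I • w)) := by
  have h1 : DifferentiableAt ℝ (fderiv ℝ u) z :=
    (hu.fderiv_right (m := 1) (by norm_cast)).differentiableAt (by simp)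
  have h2 : ∀ x : E, HasFDerivAt (fun y => fderiv ℝ u y x)
      ((ContinuousLinearMap.apply ℝ ℂ x).comp (fderiv ℝ (fderiv ℝ u) z)) z := fun x =>
    (ContinuousLinearMap.apply ℝ ℂ x).hasFDerivAt.comp z h1.hasFDerivAt
  have h3 := ((h2 w).add ((h2 (Complex.I • w)).const_mul Complex.I)).const_mul (1 / 2 : ℂ)
  have h4 := congrArg (fun L => L v) h3.fderiv
  exact h4

/-- `∂∂̄u` in terms of the second real derivative of `u`. -/
theorem ddbar_apply {u : E → ℂ} {z : E} (hu : ContDiffAt ℝ ∞ u z) (v w : E) :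
    ddbar u z ![v, w] = Complex.I / 2 * (fderiv ℝ (fderiv ℝ u) z v (Complex.I • w) -
      fderiv ℝ (fderiv ℝ u) z w (Complex.I • v)) := by
  have hs : IsSymmSndFDerivAt ℝ u z := hu.isSymmSndFDerivAt (by simp; norm_cast)
  have h0 : (fun y => dbarForm u y (Fin.removeNth 0 ![v, w])) =
      fun y => dbarForm u y (fun _ => w) := by
    funext y
    congr 1
    ext i
    fin_cases i
    rfl
  have h1 : (fun y => dbarForm u y (Fin.removeNth 1 ![v, w])) =
      fun y => dbarForm u y (fun _ => v) := by
    funext y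
    congr 1
    ext i
    fin_cases i
    rfl
  rw [ddbar, extDeriv_apply (dbarForm_differentiableAt hu), Fin.sum_univ_two, h0, h1,
    fderiv_dbarForm_apply hu, fderiv_dbarForm_apply hu]
  have h2 : fderiv ℝ (fderiv ℝ u) z v w = fderiv ℝ (fderiv ℝ u) z w v := hs v w
  simp [h2]
  ring

/-- Since `i² = -1` and the second derivative is symmetric, the two terms of `ddbar_apply` are
exchanged, each with a change of sign. This gives type `(1,1)`. -/
theorem ddbar_apply_I_smul {u : E → ℂ} {z : E} (hu : ContDiffAt ℝ ∞ u z) (v w : E) :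
    ddbar u z ![Complex.I • v, Complex.I • w] = ddbar u z ![v, w] := by
  have hs : IsSymmSndFDerivAt ℝ u z := hu.isSymmSndFDerivAt (by simp; norm_cast)
  rw [ddbar_apply hu, ddbar_apply hu, smul_smul, smul_smul, Complex.I_mul_I, neg_one_smul,
    neg_one_smul, map_neg, map_neg, hs (Complex.I • v) w, hs (Complex.I • w) v]
  ring

theorem ddbar_eq_zero_iff {u : E → ℂ} {z : E} (hu : ContDiffAt ℝ ∞ u z) :
    ddbar u z = 0 ↔ ∀ v w, fderiv ℝ (fderiv ℝ u) z v (Complex.I • w) =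
      fderiv ℝ (fderiv ℝ u) z w (Complex.I • v) := by
  constructor
  · intro h v w
    have h1 := ddbar_apply hu v w
    rw [h] at h1
    have h2 := (mul_eq_zero.1 h1.symm).resolve_left (by simp)
    exact sub_eq_zero.1 h2
  · intro h
    ext x
    have hx : x = ![x 0, x 1] := by
      ext i
      fin_cases i <;> rfl
    rw [hx, ddbar_apply hu, h, sub_self, mul_zero]
    rfl

/-- The criterion `ddbar_eq_zero_iff` involves no complex scalar in the target, so it survives any
real-linear map; the real part is the case needed. -/
theorem ddbar_clm_comp_eq_zero {u : E → ℂ} {z : E} (hu : ContDiffAt ℝ ∞ u z) (L : ℂ →L[ℝ] ℂ)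
    (h : ddbar u z = 0) : ddbar (L ∘ u) z = 0 := by
  rw [ddbar_eq_zero_iff (L.contDiff.contDiffAt.comp z hu)]
  rw [ddbar_eq_zero_iff hu] at h
  have h1 : DifferentiableAt ℝ (fderiv ℝ u) z :=
    (hu.fderiv_right (m := 1) (by norm_cast)).differentiableAt (by simp)
  have h2 : fderiv ℝ (L ∘ u) =ᶠ[𝓝 z] fun y => L.comp (fderiv ℝ u y) := by
    filter_upwards [(hu.of_le (m := 1) (by norm_cast)).eventually (by simp)] with y hy
    rw [fderiv_comp y L.differentiableAt (hy.differentiableAt (by simp)), L.fderiv]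
  have h3 : ∀ v w, fderiv ℝ (fderiv ℝ (L ∘ u)) z v w = L (fderiv ℝ (fderiv ℝ u) z v w) := by
    intro v w
    rw [h2.fderiv_eq]
    have h4 := ((ContinuousLinearMap.compL ℝ E ℂ ℂ L).hasFDerivAt.comp z h1.hasFDerivAt).fderiv
    exact congrArg (fun T => T v w) h4
  intro v w
  rw [h3, h3, h]

theorem ddbar_of_holomorphic {h : E → ℂ} {z : E} (hh : ContDiffAt ℂ ω h z) : ddbar h z = 0 := by
  have h1 : dbarForm h =ᶠ[𝓝 z] fun _ => 0 := by
    filter_upwards [(hh.of_le (m := 1) (by simp)).eventually (by simp)] with w hw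
    ext v
    rw [dbarForm_apply, dbar_apply, fderiv_real_eq_restrictScalars (hw.differentiableAt (by simp))]
    simp [← mul_assoc]
  rw [ddbar, h1.extDeriv_eq, extDeriv, fderiv_fun_const]
  exact map_zero (ContinuousAlternatingMap.alternatizeUncurryFinCLM ℝ E ℂ)

/-- `log |h|²` is pluriharmonic for a nowhere vanishing holomorphic function `h`. -/
theorem ddbar_log_normSq {h : E → ℂ} {z : E} (hh : ContDiffAt ℂ ω h z) (h0 : h z ≠ 0) :
    ddbar (fun w => (Real.log (Complex.normSq (h w)) : ℂ)) z = 0 := by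
  -- Dividing by `h z` makes the argument equal to `1` at `z`, away from the branch cut. Then `log
  -- |h|²` is `2 Re l` plus a constant near `z`.
  let l : E → ℂ := fun w => Complex.log (h w / h z)
  have hl : ContDiffAt ℂ ω l z := by
    refine (AnalyticAt.clog (hh.div contDiffAt_const h0).analyticAt ?_).contDiffAt
    change h z / h z ∈ _
    rw [div_self h0]
    exact Complex.one_mem_slitPlane
  have hl' : ContDiffAt ℝ ∞ l z := (hl.of_le (m := ∞) le_top).restrict_scalars ℝ
  let L : ℂ →L[ℝ] ℂ := (2 : ℝ) • Complex.ofRealCLM.comp Complex.reCLM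
  have h1 : ddbar (L ∘ l) z = 0 := ddbar_clm_comp_eq_zero hl' L (ddbar_of_holomorphic hl)
  have h2 : (fun w => (Real.log (Complex.normSq (h w)) : ℂ)) =ᶠ[𝓝 z]
      (L ∘ l) + fun _ => (Real.log (Complex.normSq (h z)) : ℂ) := by
    filter_upwards [hh.continuousAt.eventually_ne h0] with w hw
    have : Real.log (Complex.normSq (h w)) =
        2 * (Complex.log (h w / h z)).re + Real.log (Complex.normSq (h z)) := by
      rw [Complex.log_re, norm_div, Complex.normSq_eq_norm_sq, Complex.normSq_eq_norm_sq,
        Real.log_div (by simpa using hw) (by simpa using h0), Real.log_pow, Real.log_pow]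
      push_cast
      ring
    rw [this]
    simp [L, l]
  have h3 : ddbar (fun _ : E => (Real.log (Complex.normSq (h z)) : ℂ)) z = 0 :=
    ddbar_of_holomorphic contDiffAt_const
  rw [ddbar_congr h2, ddbar_add (L.contDiff.contDiffAt.comp z hl') contDiffAt_const, h1, h3,
    add_zero]

theorem dbarForm_contDiffAt {u : E → ℂ} {z : E} (hu : ContDiffAt ℝ ∞ u z) :
    ContDiffAt ℝ ∞ (dbarForm u) z := by
  have h1 : ContDiffAt ℝ ∞ (fderiv ℝ u) z := hu.fderiv_right (by norm_cast)
  have h2 : ContDiffAt ℝ ∞ (dbar u) z :=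
    (h1.add ((h1.clm_comp contDiffAt_const).const_smul Complex.I)).const_smul (1 / 2 : ℂ)
  exact (ContinuousAlternatingMap.ofSubsingletonLIE (𝕜 := ℝ) (E := E) (F := ℂ)
    (0 : Fin 1)).toContinuousLinearEquiv.contDiff.contDiffAt.comp z h2

theorem ddbar_contDiffAt {u : E → ℂ} {z : E} (hu : ContDiffAt ℝ ∞ u z) :
    ContDiffAt ℝ ∞ (ddbar u) z :=
  (ContinuousAlternatingMap.alternatizeUncurryFinCLM ℝ E ℂ).contDiff.contDiffAt.comp z
    ((dbarForm_contDiffAt hu).fderiv_right (by norm_cast))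

theorem extDeriv_ddbar {u : E → ℂ} {z : E} (hu : ContDiffAt ℝ ∞ u z) :
    extDeriv (ddbar u) z = 0 :=
  extDeriv_extDeriv_apply (dbarForm_contDiffAt hu) (by simp; norm_cast)

/-- In one variable, the criterion `ddbar_eq_zero_iff` at the vectors `1` and `i` says that the
Laplacian vanishes. -/
theorem harmonicAt_of_ddbar_eq_zero {u : ℂ → ℂ} (hu : ContDiff ℝ ∞ u)
    (h : ∀ w, ddbar u w = 0) (z : ℂ) : InnerProductSpace.HarmonicAt u z := by
  refine ⟨hu.contDiffAt.of_le (by norm_cast), .of_forall fun w => ?_⟩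
  have h1 := (ddbar_eq_zero_iff hu.contDiffAt).1 (h w) 1 Complex.I
  rw [InnerProductSpace.laplacian_eq_iteratedFDeriv_complexPlane]
  simp only [smul_eq_mul, Complex.I_mul_I, mul_one, map_neg] at h1
  simp [iteratedFDeriv_two_apply, ← h1]

/-- The restriction to a complex line is harmonic, so the mean value property applies. Only the
points of this line matter, which allows a singularity of `u` elsewhere. -/
theorem circleAverage_line_of_pluriharmonic {u : E → ℂ} {z a : E}
    (hu : ∀ t : ℂ, ContDiffAt ℝ ∞ u (z + t • a)) (h : ∀ t : ℂ, ddbar u (z + t • a) = 0) (r : ℝ) :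
    Real.circleAverage (fun t : ℂ => u (z + t • a)) 0 r = u z := by
  have hF : ContDiff ℂ ω fun t : ℂ => z + t • a :=
    contDiff_const.add (contDiff_id.smul contDiff_const)
  have hF' : ContDiff ℝ ∞ fun t : ℂ => z + t • a := (hF.of_le (m := ∞) le_top).restrict_scalars ℝ
  have h1 : ContDiff ℝ ∞ fun t : ℂ => u (z + t • a) :=
    contDiff_iff_contDiffAt.2 fun t => (hu t).comp t hF'.contDiffAt
  have h2 : ∀ t, ddbar (fun t : ℂ => u (z + t • a)) t = 0 := fun t => by
    have h3 := ddbar_comp (F := fun t : ℂ => z + t • a) (hu t) hF.contDiffAt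
    rw [h t] at h3
    exact h3
  have h3 : InnerProductSpace.HarmonicOnNhd (fun t : ℂ => u (z + t • a))
      (Metric.closedBall 0 |r|) := fun t _ => harmonicAt_of_ddbar_eq_zero h1 h2 t
  rw [h3.circleAverage_eq, zero_smul, add_zero]

theorem norm_le_of_pluriharmonic_line {u : E → ℂ} {z a : E}
    (hu : ∀ t : ℂ, ContDiffAt ℝ ∞ u (z + t • a)) (h : ∀ t : ℂ, ddbar u (z + t • a) = 0) {C : ℝ}
    (hC : ∀ t : ℂ, ‖t‖ = 1 → ‖u (z + t • a)‖ ≤ C) : ‖u z‖ ≤ C := by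
  rw [← circleAverage_line_of_pluriharmonic hu h 1, Real.circleAverage, norm_smul]
  have h1 := intervalIntegral.norm_integral_le_of_norm_le_const (a := 0) (b := 2 * Real.pi) (C := C)
    (f := fun θ => u (z + circleMap 0 1 θ • a)) fun θ _ => hC _ (by simp)
  rw [sub_zero, abs_of_pos Real.two_pi_pos] at h1
  rw [Real.norm_of_nonneg (inv_nonneg.2 Real.two_pi_pos.le)]
  calc _ ≤ (2 * Real.pi)⁻¹ * (C * (2 * Real.pi)) :=
        mul_le_mul_of_nonneg_left h1 (inv_nonneg.2 Real.two_pi_pos.le)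
    _ = C := by field_simp

end LocalDdbar

/-- Unlike `gramMatrix_comp`, this names the change-of-basis matrix, so that its determinant can be
recognised as `jacobian`. -/
theorem gramMatrix_comp_linearMap {n : ℕ} {V : Type*} [AddCommGroup V] [Module ℂ V]
    (h : V →ₗ⋆[ℂ] V →ₗ[ℂ] ℂ) (L : Cn n →ₗ[ℂ] V) (B : Cn n →ₗ[ℂ] Cn n) :
    gramMatrix h (L ∘ₗ B) =
      (Matrix.of fun j k => B (EuclideanSpace.single k 1) j).conjTranspose * gramMatrix h L *
        Matrix.of fun j k => B (EuclideanSpace.single k 1) j := by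
  ext a b
  have := gramMatrix_dotProduct h L (B (EuclideanSpace.single a 1)) (B (EuclideanSpace.single b 1))
  rw [Matrix.mul_assoc]
  simp only [Matrix.mul_apply, Matrix.conjTranspose_apply, Matrix.of_apply, Finset.mul_sum]
  simp only [mul_assoc] at this
  exact this

/-! ### The group action by holomorphic maps, and an invariant metric. -/

namespace HolomorphicContraction

variable {n : ℕ} (γ : HolomorphicContraction n)

/-- A holomorphic map of `ℂⁿ` extending an element of the group. -/
def extend (g : γ.group) : Cn n → Cn n := (γ.exists_holomorphic g.2).choose

theorem extend_contDiff (g : γ.group) : ContDiff ℂ ω (γ.extend g) :=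
  (γ.exists_holomorphic g.2).choose_spec.1

theorem coe_apply (g : γ.group) (z : PuncturedCn n) : (g.1 z : Cn n) = γ.extend g z :=
  (γ.exists_holomorphic g.2).choose_spec.2 z

variable {γ} in
theorem extend_differentiable (g : γ.group) : Differentiable ℂ (γ.extend g) :=
  (γ.extend_contDiff g).differentiable (by simp)

theorem extend_ne_zero (g : γ.group) {z : Cn n} (hz : z ≠ 0) : γ.extend g z ≠ 0 := by
  rw [← γ.coe_apply g ⟨z, hz⟩]
  exact (g.1 _).2

theorem extend_mul (g h : γ.group) {z : Cn n} (hz : z ≠ 0) :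
    γ.extend (g * h) z = γ.extend g (γ.extend h z) := by
  rw [← γ.coe_apply (g * h) ⟨z, hz⟩, ← γ.coe_apply h ⟨z, hz⟩, ← γ.coe_apply g]
  rfl

theorem extend_one {z : Cn n} (hz : z ≠ 0) : γ.extend 1 z = z :=
  (γ.coe_apply 1 ⟨z, hz⟩).symm

theorem fderiv_extend_mul (g h : γ.group) {z : Cn n} (hz : z ≠ 0) :
    fderiv ℂ (γ.extend (g * h)) z =
      (fderiv ℂ (γ.extend g) (γ.extend h z)).comp (fderiv ℂ (γ.extend h) z) := by
  rw [← fderiv_comp z (extend_differentiable g _) (extend_differentiable h z)]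
  refine Filter.EventuallyEq.fderiv_eq ?_
  filter_upwards [isOpen_compl_singleton.mem_nhds hz] with w hw
  exact γ.extend_mul g h hw

theorem fderiv_extend_one {z : Cn n} (hz : z ≠ 0) :
    fderiv ℂ (γ.extend 1) z = ContinuousLinearMap.id ℂ (Cn n) := by
  rw [← fderiv_id (x := z)]
  refine Filter.EventuallyEq.fderiv_eq ?_
  filter_upwards [isOpen_compl_singleton.mem_nhds hz] with w hw
  exact γ.extend_one hw

/-- By the chain rule, the derivative of `g⁻¹` at the image point is a left inverse. -/
theorem fderiv_extend_injective (g : γ.group) {z : Cn n} (hz : z ≠ 0) :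
    Function.Injective (fderiv ℂ (γ.extend g) z) := by
  have h := γ.fderiv_extend_mul g⁻¹ g hz
  rw [inv_mul_cancel, γ.fderiv_extend_one hz] at h
  refine Function.LeftInverse.injective (g := fderiv ℂ (γ.extend g⁻¹) (γ.extend g z)) fun v => ?_
  exact (congrArg (fun L => L v) h).symm

/-- Every orbit meets a suitable shell. -/
theorem exists_shell : ∃ R : ℝ, ∀ z : PuncturedCn n, ∃ g : γ.group,
    1 < ‖(g.1 z : Cn n)‖ ∧ ‖(g.1 z : Cn n)‖ < R := by
  have hK : IsCompact (Metric.closedBall (0 : Cn n) 1) := isCompact_closedBall 0 1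
  -- `R` bounds the preimage under `γ` of the closed unit ball: a point that enters the ball in one
  -- step has norm less than `R`.
  obtain ⟨R, hR⟩ := ((hK.image γ.holomorphic_symm.continuous).isBounded).subset_ball 0
  refine ⟨R, fun z => ?_⟩
  -- Some backward iterate leaves the unit ball. Otherwise `z = γᵏ(γ⁻ᵏ z)` would lie in the image of
  -- the ball under `γᵏ`, which avoids `z` for large `k`.
  obtain ⟨j, hj⟩ : ∃ j : ℕ, 1 < ‖(((γ.perm ^ j)⁻¹ z : PuncturedCn n) : Cn n)‖ := by
    by_contra! h
    have hU : {(z : Cn n)}ᶜ ∈ 𝓝 (0 : Cn n) :=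
      isOpen_compl_singleton.mem_nhds fun h0 => z.2 (by simpa using h0.symm)
    obtain ⟨k, hk⟩ := (γ.contracting _ hK _ hU).exists
    refine hk (mem_closedBall_zero_iff.2 (h k)) ?_
    rw [← γ.perm_pow_coe]
    exact congrArg Subtype.val ((γ.perm ^ k).apply_symm_apply z)
  obtain ⟨y, hy⟩ : ∃ y, y = (γ.perm ^ j)⁻¹ z := ⟨_, rfl⟩
  rw [← hy] at hj
  have hex : ∃ k : ℕ, ‖(((γ.perm ^ k) y : PuncturedCn n) : Cn n)‖ ≤ 1 := by
    obtain ⟨k, hk⟩ := (γ.contracting {(y : Cn n)} isCompact_singleton _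
      (Metric.closedBall_mem_nhds 0 one_pos)).exists
    refine ⟨k, ?_⟩
    rw [γ.perm_pow_coe]
    exact mem_closedBall_zero_iff.1 (hk rfl)
  classical
  -- The orbit of `y` starts outside the ball, so the first entry time is positive; the shell point
  -- is the iterate just before entry.
  obtain ⟨m, hm⟩ : ∃ m, Nat.find hex = m + 1 := by
    refine Nat.exists_eq_succ_of_ne_zero fun h0 => ?_
    have := Nat.find_spec hex
    rw [h0, pow_zero] at this
    exact hj.not_ge this
  have h1 := Nat.find_spec hex
  have h2 := Nat.find_min hex (m := m) (hm ▸ Nat.lt_succ_self m)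
  rw [hm] at h1
  refine ⟨⟨γ.perm ^ m * (γ.perm ^ j)⁻¹, mul_mem (pow_mem (Subgroup.mem_zpowers _) _)
    (inv_mem (pow_mem (Subgroup.mem_zpowers _) _))⟩, ?_⟩
  change 1 < ‖(((γ.perm ^ m) ((γ.perm ^ j)⁻¹ z) : PuncturedCn n) : Cn n)‖ ∧
    ‖(((γ.perm ^ m) ((γ.perm ^ j)⁻¹ z) : PuncturedCn n) : Cn n)‖ < R
  rw [← hy]
  refine ⟨not_le.1 h2, ?_⟩
  have h3 : (((γ.perm ^ m) y : PuncturedCn n) : Cn n) ∈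
      γ.toEquiv.symm '' Metric.closedBall (0 : Cn n) 1 := by
    refine ⟨_, mem_closedBall_zero_iff.2 h1, ?_⟩
    rw [pow_succ', Equiv.Perm.mul_apply]
    exact γ.toEquiv.symm_apply_apply _
  exact mem_ball_zero_iff.1 (hR h3)

/-- Take a smooth function whose nonvanishing set is exactly the open shell of `exists_shell`. The
closed shell is compact and misses the origin. -/
theorem exists_cutoff : ∃ φ : Cn n → ℝ, ContDiff ℝ ∞ φ ∧ (∀ z, 0 ≤ φ z) ∧
    (∃ K : Set (PuncturedCn n), IsCompact K ∧ ∀ z : PuncturedCn n, φ z ≠ 0 → z ∈ K) ∧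
    ∀ z : PuncturedCn n, ∃ g : γ.group, 0 < φ (g.1 z) := by
  obtain ⟨R, hR⟩ := γ.exists_shell
  have hs : IsOpen {w : Cn n | 1 < ‖w‖ ∧ ‖w‖ < R} :=
    (isOpen_lt continuous_const continuous_norm).inter (isOpen_lt continuous_norm continuous_const)
  obtain ⟨φ, h1, h2, h3⟩ := hs.exists_contDiff_support_eq (n := ⊤)
  have h4 : ∀ z, 0 ≤ φ z := fun z => (h3 ⟨z, rfl⟩).1
  refine ⟨φ, h2, h4, ⟨(↑) ⁻¹' {w : Cn n | 1 ≤ ‖w‖ ∧ ‖w‖ ≤ R}, ?_, fun z hz => ?_⟩, fun z => ?_⟩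
  · have h5 : IsCompact {w : Cn n | 1 ≤ ‖w‖ ∧ ‖w‖ ≤ R} := by
      refine (isCompact_closedBall (0 : Cn n) R).of_isClosed_subset
        ((isClosed_le continuous_const continuous_norm).inter
          (isClosed_le continuous_norm continuous_const)) fun w hw => ?_
      exact mem_closedBall_zero_iff.2 hw.2
    refine Topology.IsInducing.subtypeVal.isCompact_preimage' h5 fun w hw => ?_
    refine ⟨⟨w, fun h0 : w = 0 => ?_⟩, rfl⟩
    have := hw.1
    rw [h0, norm_zero] at this
    exact absurd this (by norm_num)
  · have h5 : (z : Cn n) ∈ φ.support := hz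
    rw [h1] at h5
    exact ⟨h5.1.le, h5.2.le⟩
  · obtain ⟨g, hg⟩ := hR z
    have h5 : (g.1 z : Cn n) ∈ φ.support := by
      rw [h1]
      exact hg
    exact ⟨g, lt_of_le_of_ne (h4 _) (Ne.symm h5)⟩

/-- A smooth nonnegative function, supported in a compact subset of `ℂⁿ ∖ {0}` and positive
somewhere on every orbit. -/
def cutoff : Cn n → ℝ := γ.exists_cutoff.choose

theorem cutoff_contDiff : ContDiff ℝ ∞ γ.cutoff := γ.exists_cutoff.choose_spec.1

theorem cutoff_nonneg (z : Cn n) : 0 ≤ γ.cutoff z := γ.exists_cutoff.choose_spec.2.1 z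

theorem cutoff_support : ∃ K : Set (PuncturedCn n), IsCompact K ∧
    ∀ z : PuncturedCn n, γ.cutoff z ≠ 0 → z ∈ K := γ.exists_cutoff.choose_spec.2.2.1

theorem cutoff_pos {z : Cn n} (hz : z ≠ 0) : ∃ g : γ.group, 0 < γ.cutoff (γ.extend g z) := by
  obtain ⟨g, hg⟩ := γ.exists_cutoff.choose_spec.2.2.2 ⟨z, hz⟩
  refine ⟨g, ?_⟩
  rw [γ.coe_apply] at hg
  exact hg

/-- The pull-back by `g` of the Euclidean metric multiplied by the cutoff. -/
def pullbackTerm (g : γ.group) (z : Cn n) : Cn n →ₗ⋆[ℂ] Cn n →ₗ[ℂ] ℂ :=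
  LinearMap.mk₂'ₛₗ (starRingEnd ℂ) (RingHom.id ℂ)
    (fun v w => (γ.cutoff (γ.extend g z) : ℂ) *
      inner ℂ (fderiv ℂ (γ.extend g) z v) (fderiv ℂ (γ.extend g) z w))
    (fun v v' w => by rw [map_add, inner_add_left, mul_add])
    (fun c v w => by rw [map_smul, inner_smul_left, mul_left_comm]; rfl)
    (fun v w w' => by rw [map_add, inner_add_right, mul_add])
    (fun c v w => by rw [map_smul, inner_smul_right, mul_left_comm]; rfl)

theorem pullbackTerm_apply (g : γ.group) (z v w : Cn n) :
    γ.pullbackTerm g z v w = (γ.cutoff (γ.extend g z) : ℂ) *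
      inner ℂ (fderiv ℂ (γ.extend g) z v) (fderiv ℂ (γ.extend g) z w) := rfl

theorem pullbackTerm_eq_zero {g : γ.group} {z : Cn n} (h : γ.cutoff (γ.extend g z) = 0) :
    γ.pullbackTerm g z = 0 := by
  ext v w
  simp [pullbackTerm_apply, h]

/-- A `γ`-invariant Hermitian metric on `ℂⁿ ∖ {0}`. -/
def invariantMetric (z : Cn n) : Cn n →ₗ⋆[ℂ] Cn n →ₗ[ℂ] ℂ := ∑ᶠ g : γ.group, γ.pullbackTerm g z

/-- Proper discontinuity makes the averaging sum locally finite, so near `z₀` the `finsum` is a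
genuine finite sum over a fixed index set rather than its default value `0`. -/
theorem exists_finset_cutoff_eq_zero {z₀ : Cn n} (hz₀ : z₀ ≠ 0) : ∃ s : Finset γ.group,
    ∀ᶠ z in 𝓝 z₀, ∀ g ∉ s, γ.cutoff (γ.extend g z) = 0 := by
  obtain ⟨K, hK, h⟩ := γ.cutoff_support
  obtain ⟨N, hN, hN'⟩ := exists_compact_mem_nhds (⟨z₀, hz₀⟩ : PuncturedCn n)
  have hfin : {g : γ.group | ((g • ·) '' N ∩ K).Nonempty}.Finite :=
    ProperlyDiscontinuousSMul.finite_disjoint_inter_image hN hK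
  refine ⟨hfin.toFinset, ?_⟩
  have h1 : (↑) '' N ∈ 𝓝 z₀ :=
    (PuncturedCn n).isOpen.isOpenEmbedding_subtypeVal.isOpenMap.image_mem_nhds hN'
  filter_upwards [h1] with z hz g hg
  obtain ⟨y, hy, rfl⟩ := hz
  by_contra h2
  refine hg (hfin.mem_toFinset.2 ⟨_, ⟨y, hy, rfl⟩, h _ ?_⟩)
  rwa [← γ.coe_apply] at h2

theorem invariantMetric_eq_sum {s : Finset γ.group} {z : Cn n}
    (h : ∀ g ∉ s, γ.cutoff (γ.extend g z) = 0) :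
    γ.invariantMetric z = ∑ g ∈ s, γ.pullbackTerm g z := by
  refine finsum_eq_sum_of_support_subset _ fun g hg => ?_
  by_contra h1
  exact hg (γ.pullbackTerm_eq_zero (h g h1))

theorem invariantMetric_apply_eq_sum {s : Finset γ.group} {z : Cn n}
    (h : ∀ g ∉ s, γ.cutoff (γ.extend g z) = 0) (v w : Cn n) :
    γ.invariantMetric z v w = ∑ g ∈ s, γ.pullbackTerm g z v w := by
  rw [γ.invariantMetric_eq_sum h]
  simp only [LinearMap.sum_apply]

theorem invariantMetric_apply {z : Cn n} (hz : z ≠ 0) (v w : Cn n) :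
    γ.invariantMetric z v w = ∑ᶠ g : γ.group, γ.pullbackTerm g z v w := by
  obtain ⟨s, hs⟩ := γ.exists_finset_cutoff_eq_zero hz
  rw [γ.invariantMetric_apply_eq_sum hs.self_of_nhds, finsum_eq_sum_of_support_subset _ fun g hg => ?_]
  by_contra h1
  refine hg ?_
  beta_reduce
  rw [γ.pullbackTerm_eq_zero (hs.self_of_nhds g h1)]
  rfl

/-- Pulling back by `h` turns the term of `g` into the term of `g * h`, and right multiplication
permutes the group. -/
theorem invariantMetric_pullback (h : γ.group) {z : Cn n} (hz : z ≠ 0) (v w : Cn n) :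
    γ.invariantMetric (γ.extend h z) (fderiv ℂ (γ.extend h) z v) (fderiv ℂ (γ.extend h) z w) =
      γ.invariantMetric z v w := by
  rw [γ.invariantMetric_apply hz, γ.invariantMetric_apply (γ.extend_ne_zero h hz),
    ← finsum_comp_equiv (Equiv.mulRight h) (f := fun g => γ.pullbackTerm g z v w)]
  refine finsum_congr fun g => ?_
  rw [Equiv.coe_mulRight]
  beta_reduce
  rw [pullbackTerm_apply, pullbackTerm_apply, γ.extend_mul g h hz,
    γ.fderiv_extend_mul g h hz]
  rfl

theorem invariantMetric_conj_symm {z : Cn n} (hz : z ≠ 0) (v w : Cn n) :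
    (starRingEnd ℂ) (γ.invariantMetric z v w) = γ.invariantMetric z w v := by
  obtain ⟨s, hs⟩ := γ.exists_finset_cutoff_eq_zero hz
  rw [γ.invariantMetric_apply_eq_sum hs.self_of_nhds,
    γ.invariantMetric_apply_eq_sum hs.self_of_nhds, map_sum]
  refine Finset.sum_congr rfl fun g _ => ?_
  rw [pullbackTerm_apply, pullbackTerm_apply, map_mul, Complex.conj_ofReal, inner_conj_symm]

theorem invariantMetric_pos {z : Cn n} (hz : z ≠ 0) {v : Cn n} (hv : v ≠ 0) :
    0 < (γ.invariantMetric z v v).re := by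
  obtain ⟨s, hs⟩ := γ.exists_finset_cutoff_eq_zero hz
  have hre : ∀ g : γ.group, (γ.pullbackTerm g z v v).re =
      γ.cutoff (γ.extend g z) * ‖fderiv ℂ (γ.extend g) z v‖ ^ 2 := by
    intro g
    rw [pullbackTerm_apply, Complex.re_ofReal_mul, inner_self_eq_norm_sq_to_K]
    norm_cast
  rw [γ.invariantMetric_apply_eq_sum hs.self_of_nhds, Complex.re_sum]
  obtain ⟨g, hg⟩ := γ.cutoff_pos hz
  refine Finset.sum_pos' (fun g _ => ?_) ⟨g, ?_, ?_⟩
  · rw [hre]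
    exact mul_nonneg (γ.cutoff_nonneg _) (sq_nonneg _)
  · by_contra h1
    exact hg.ne' (hs.self_of_nhds g h1)
  · rw [hre]
    refine mul_pos hg (pow_pos (norm_pos_iff.2 fun h0 => hv ?_) 2)
    exact γ.fderiv_extend_injective g hz (h0.trans (_root_.map_zero _).symm)

theorem fderiv_extend_contDiff (g : γ.group) (v : Cn n) :
    ContDiff ℂ ω fun z => fderiv ℂ (γ.extend g) z v :=
  ((γ.extend_contDiff g).fderiv_right (m := ω) (by simp)).clm_apply contDiff_const

theorem invariantMetric_contDiffAt {z : Cn n} (hz : z ≠ 0) (v w : Cn n) :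
    ContDiffAt ℝ ∞ (fun z => γ.invariantMetric z v w) z := by
  obtain ⟨s, hs⟩ := γ.exists_finset_cutoff_eq_zero hz
  have h1 : (fun z => γ.invariantMetric z v w) =ᶠ[𝓝 z]
      fun z => ∑ g ∈ s, γ.pullbackTerm g z v w := by
    filter_upwards [hs] with y hy
    exact γ.invariantMetric_apply_eq_sum hy v w
  refine ContDiffAt.congr_of_eventuallyEq ?_ h1
  refine ContDiffAt.sum fun g _ => ContDiff.contDiffAt ?_
  have h2 : ∀ v, ContDiff ℝ ∞ fun z => fderiv ℂ (γ.extend g) z v := fun v =>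
    ((γ.fderiv_extend_contDiff g v).of_le (m := ∞) le_top).restrict_scalars ℝ
  have h3 : ContDiff ℝ ∞ (γ.extend g) :=
    ((γ.extend_contDiff g).of_le (m := ∞) le_top).restrict_scalars ℝ
  exact (Complex.ofRealCLM.contDiff.comp (γ.cutoff_contDiff.comp h3)).mul ((h2 v).inner ℂ (h2 w))

/-! ### The determinant of the invariant metric and the Jacobian cocycle. -/

/-- The logarithm of the determinant of the invariant metric. -/
def logDetMetric (z : Cn n) : ℝ :=
  Real.log (gramMatrix (γ.invariantMetric z) LinearMap.id).det.re

/-- The complex Jacobian determinant of an element of the group. -/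
def jacobian (g : γ.group) (z : Cn n) : ℂ :=
  (Matrix.of fun j k => fderiv ℂ (γ.extend g) z (EuclideanSpace.single k 1) j).det

theorem jacobian_contDiff (g : γ.group) : ContDiff ℂ ω (γ.jacobian g) := by
  unfold jacobian
  simp only [Matrix.det_apply]
  refine ContDiff.sum fun σ _ => ContDiff.const_smul _ (contDiff_prod fun j _ => ?_)
  exact (EuclideanSpace.proj (𝕜 := ℂ) (σ j)).contDiff.comp
    (γ.fderiv_extend_contDiff g (EuclideanSpace.single j 1))

theorem det_gramMatrix_invariantMetric_pos {z : Cn n} (hz : z ≠ 0) :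
    0 < (gramMatrix (γ.invariantMetric z) LinearMap.id).det.re :=
  gramMatrix_det_pos _ (γ.invariantMetric_conj_symm hz) (fun _ hv => γ.invariantMetric_pos hz hv)
    _ Function.injective_id

theorem logDetMetric_contDiffAt {z : Cn n} (hz : z ≠ 0) :
    ContDiffAt ℝ ∞ (fun w => (γ.logDetMetric w : ℂ)) z := by
  refine Complex.ofRealCLM.contDiff.contDiffAt.comp z
    (ContDiffAt.log ?_ (γ.det_gramMatrix_invariantMetric_pos hz).ne')
  refine Complex.reCLM.contDiff.contDiffAt.comp z ?_
  simp only [Matrix.det_apply]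
  refine ContDiffAt.sum fun σ _ => ContDiffAt.const_smul _ (contDiffAt_prod fun j _ => ?_)
  exact γ.invariantMetric_contDiffAt hz _ _

/-- By invariance the Gram matrix at `z` is `Jᴴ G J`, with `G` the Gram matrix at the image point
and `J` the Jacobian matrix of `g`. -/
theorem det_gramMatrix_invariantMetric (g : γ.group) {z : Cn n} (hz : z ≠ 0) :
    (gramMatrix (γ.invariantMetric z) LinearMap.id).det.re = Complex.normSq (γ.jacobian g z) *
      (gramMatrix (γ.invariantMetric (γ.extend g z)) LinearMap.id).det.re := by
  have h1 : gramMatrix (γ.invariantMetric z) LinearMap.id =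
      gramMatrix (γ.invariantMetric (γ.extend g z))
        (LinearMap.id ∘ₗ (fderiv ℂ (γ.extend g) z).toLinearMap) := by
    ext j k
    exact (γ.invariantMetric_pullback g hz _ _).symm
  rw [h1, gramMatrix_comp_linearMap, Matrix.det_mul, Matrix.det_mul, Matrix.det_conjTranspose,
    mul_right_comm, Complex.star_def, ← Complex.normSq_eq_conj_mul_self, Complex.re_ofReal_mul]
  rfl

theorem jacobian_ne_zero (g : γ.group) {z : Cn n} (hz : z ≠ 0) : γ.jacobian g z ≠ 0 := by
  intro h
  have h1 := γ.det_gramMatrix_invariantMetric_pos hz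
  rw [γ.det_gramMatrix_invariantMetric g hz, h, _root_.map_zero, zero_mul] at h1
  exact h1.false

/-- This cocycle relation serves twice: it makes the Ricci form invariant, and it governs the growth
of `logDetMetric` along orbits. -/
theorem logDetMetric_eq (g : γ.group) {z : Cn n} (hz : z ≠ 0) :
    γ.logDetMetric z = Real.log (Complex.normSq (γ.jacobian g z)) +
      γ.logDetMetric (γ.extend g z) := by
  rw [logDetMetric, γ.det_gramMatrix_invariantMetric g hz, Real.log_mul
    (Complex.normSq_pos.2 (γ.jacobian_ne_zero g hz)).ne'
    (γ.det_gramMatrix_invariantMetric_pos (γ.extend_ne_zero g hz)).ne']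
  rfl

/-- The Chern–Ricci form of the invariant metric is invariant. -/
theorem ddbar_logDetMetric_pullback (g : γ.group) {z : Cn n} (hz : z ≠ 0) :
    (ddbar (fun w => (γ.logDetMetric w : ℂ)) (γ.extend g z)).compContinuousLinearMap
      ((fderiv ℂ (γ.extend g) z).restrictScalars ℝ) =
    ddbar (fun w => (γ.logDetMetric w : ℂ)) z := by
  have hs := γ.logDetMetric_contDiffAt (γ.extend_ne_zero g hz)
  rw [← ddbar_comp hs (γ.extend_contDiff g).contDiffAt]
  let l : Cn n → ℂ := fun w => (Real.log (Complex.normSq (γ.jacobian g w)) : ℂ)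
  have h1 : (fun w => (γ.logDetMetric w : ℂ)) =ᶠ[𝓝 z]
      l + (fun w => (γ.logDetMetric w : ℂ)) ∘ γ.extend g := by
    filter_upwards [isOpen_compl_singleton.mem_nhds hz] with w hw
    rw [γ.logDetMetric_eq g hw]
    simp [l]
  have hj : ContDiffAt ℝ ∞ (γ.jacobian g) z :=
    (((γ.jacobian_contDiff g).of_le (m := ∞) le_top).restrict_scalars ℝ).contDiffAt
  have hl : ContDiffAt ℝ ∞ l z := by
    refine Complex.ofRealCLM.contDiff.contDiffAt.comp z
      (ContDiffAt.log ?_ (Complex.normSq_pos.2 (γ.jacobian_ne_zero g hz)).ne')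
    simp only [Complex.normSq_apply]
    have hr := Complex.reCLM.contDiff.contDiffAt.comp z hj
    have hi := Complex.imCLM.contDiff.contDiffAt.comp z hj
    exact (hr.mul hr).add (hi.mul hi)
  have he : ContDiffAt ℝ ∞ (γ.extend g) z :=
    (((γ.extend_contDiff g).of_le (m := ∞) le_top).restrict_scalars ℝ).contDiffAt
  rw [ddbar_congr h1, ddbar_add hl (hs.comp z he),
    ddbar_log_normSq (γ.jacobian_contDiff g).contDiffAt (γ.jacobian_ne_zero g hz), zero_add]

end HolomorphicContraction

/-! ### Descent of the metric and of its Chern–Ricci form to the Hopf manifold. -/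

namespace HolomorphicContraction

variable {n : ℕ} (γ : HolomorphicContraction n)

/-- The quotient map `ℂⁿ ∖ {0} → X`. -/
def proj (z : PuncturedCn n) : HopfManifold γ := Quotient.mk _ z

theorem proj_eq_iff {z w : PuncturedCn n} : γ.proj z = γ.proj w ↔ ∃ g : γ.group, g • w = z :=
  Quotient.eq.trans MulAction.orbitRel_apply

theorem proj_smul (g : γ.group) (z : PuncturedCn n) : γ.proj (g • z) = γ.proj z :=
  γ.proj_eq_iff.2 ⟨g, rfl⟩

variable {γ}

/-- Each chart is a local inverse of the quotient map followed by the inclusion into `ℂⁿ`, so chart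
coordinates are points of the cover. -/
theorem atlas_symm_eq_proj {e : OpenPartialHomeomorph (HopfManifold γ) (Cn n)}
    (he : e ∈ atlas (Cn n) (HopfManifold γ)) {z : Cn n} (hz : z ∈ e.target) :
    ∃ h : z ≠ 0, e.symm z = γ.proj ⟨z, h⟩ := by
  obtain ⟨q, rfl⟩ := he
  have h1 := (chartAt (Cn n) (Function.surjInv Quotient.mk_surjective q)).right_inv hz.1
  have h2 : ((chartAt (Cn n) (Function.surjInv Quotient.mk_surjective q)).symm z : Cn n) = z := h1
  refine ⟨fun h0 => ?_, ?_⟩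
  · exact ((chartAt (Cn n) (Function.surjInv Quotient.mk_surjective q)).symm z).2 (h2.trans h0)
  · rw [OpenPartialHomeomorph.trans_symm_eq_symm_trans_symm, OpenPartialHomeomorph.coe_trans,
      IsLocalHomeomorph.localInverseAt_symm]
    exact congrArg γ.proj (Subtype.ext h2)

theorem ne_zero_of_mem_target {e : OpenPartialHomeomorph (HopfManifold γ) (Cn n)}
    (he : e ∈ atlas (Cn n) (HopfManifold γ)) {z : Cn n} (hz : z ∈ e.target) : z ≠ 0 :=
  (atlas_symm_eq_proj he hz).1

/-- Near a point which the quotient map sends into the domain of a chart `e`, the composition of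
`e` with the quotient map is an element of the group. -/
theorem exists_atlas_proj_eq {e : OpenPartialHomeomorph (HopfManifold γ) (Cn n)}
    (he : e ∈ atlas (Cn n) (HopfManifold γ)) {z : PuncturedCn n} (hz : γ.proj z ∈ e.source) :
    ∃ g : γ.group, e (γ.proj z) = γ.extend g z ∧ ∀ᶠ w in 𝓝 (z : Cn n), ∃ h : w ≠ 0,
      γ.extend g w ∈ e.target ∧ e.symm (γ.extend g w) = γ.proj ⟨w, h⟩ := by
  obtain ⟨h0, h1⟩ := atlas_symm_eq_proj he (e.map_source hz)
  rw [e.left_inv hz] at h1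
  obtain ⟨g, hg⟩ := γ.proj_eq_iff.1 h1.symm
  have hg' : e (γ.proj z) = γ.extend g z := by
    rw [← γ.coe_apply]
    exact (congrArg Subtype.val hg).symm
  refine ⟨g, hg', ?_⟩
  have h2 : ∀ᶠ w in 𝓝 (z : Cn n), γ.extend g w ∈ e.target := by
    refine (γ.extend_contDiff g).continuous.continuousAt.eventually_mem
      (e.open_target.mem_nhds ?_)
    rw [← hg']
    exact e.map_source hz
  filter_upwards [h2, isOpen_compl_singleton.mem_nhds z.2] with w hw hw0
  refine ⟨hw0, hw, ?_⟩
  obtain ⟨h3, h4⟩ := atlas_symm_eq_proj he hw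
  rw [h4, ← γ.proj_smul g ⟨w, hw0⟩]
  exact congrArg γ.proj (Subtype.ext (γ.coe_apply g ⟨w, hw0⟩).symm)

/-- The derivative of the inverse of a chart, in terms of an element of the group. -/
theorem exists_chartSymmDeriv_eq {e : OpenPartialHomeomorph (HopfManifold γ) (Cn n)}
    (he : e ∈ atlas (Cn n) (HopfManifold γ)) {z : Cn n} (hz : z ∈ e.target) :
    ∃ g : γ.group, chartAt (Cn n) (e.symm z) (e.symm z) = γ.extend g z ∧
      (chartSymmDeriv e z : Cn n →L[ℂ] Cn n) = fderiv ℂ (γ.extend g) z := by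
  obtain ⟨h0, h1⟩ := atlas_symm_eq_proj he hz
  have h2 : γ.proj ⟨z, h0⟩ ∈ (chartAt (Cn n) (e.symm z)).source := by
    rw [← h1]
    exact mem_chart_source (Cn n) (e.symm z)
  obtain ⟨g, hg, hev⟩ := exists_atlas_proj_eq (chart_mem_atlas (Cn n) (e.symm z)) h2
  rw [← h1] at hg
  refine ⟨g, hg, ?_⟩
  have : IsManifold 𝓘(ℂ, Cn n) 1 (HopfManifold γ) := .of_le (n := ω) (by simp)
  have hd : MDifferentiableAt 𝓘(ℂ, Cn n) 𝓘(ℂ, Cn n) e.symm z :=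
    (mdifferentiable_of_mem_atlas (I := 𝓘(ℂ, Cn n)) he).symm.mdifferentiableAt hz
  have h3 : (fun w => chartAt (Cn n) (e.symm z) (e.symm w)) =ᶠ[𝓝 z] γ.extend g := by
    filter_upwards [hev, e.open_target.mem_nhds hz] with w ⟨h4, h5, h6⟩ h7
    obtain ⟨_, h8⟩ := atlas_symm_eq_proj he h7
    rw [h8, ← h6, OpenPartialHomeomorph.right_inv _ h5]
  rw [← h3.fderiv_eq]
  -- `mfderiv` is the derivative of `e.symm` read in the preferred chart at the image point, which
  -- is the map in `h3`.
  have h4 := hd.mfderiv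
  rw [ModelWithCorners.range_eq_univ, fderivWithin_univ] at h4
  exact h4

variable (γ) in
/-- The metric on the Hopf manifold induced by the invariant metric. -/
def hopfInner (x : HopfManifold γ) :
    TangentSpace 𝓘(ℂ, Cn n) x →ₗ⋆[ℂ] TangentSpace 𝓘(ℂ, Cn n) x →ₗ[ℂ] ℂ :=
  -- The tangent space at `x` is the model space `ℂⁿ`, identified through the preferred chart at
  -- `x`.
  γ.invariantMetric (chartAt (Cn n) x x)

/-- The passage from `e` to the preferred chart is an element of the group, so invariance removes
the dependence on the preferred chart. -/
theorem hopfInner_chartSymmDeriv {e : OpenPartialHomeomorph (HopfManifold γ) (Cn n)}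
    (he : e ∈ atlas (Cn n) (HopfManifold γ)) {z : Cn n} (hz : z ∈ e.target) (v w : Cn n) :
    γ.hopfInner (e.symm z) (chartSymmDeriv e z v) (chartSymmDeriv e z w) =
      γ.invariantMetric z v w := by
  obtain ⟨g, hg, hd⟩ := exists_chartSymmDeriv_eq he hz
  rw [← γ.invariantMetric_pullback g (ne_zero_of_mem_target he hz), ← hg, ← hd]
  rfl

theorem chartAt_self_ne_zero (x : HopfManifold γ) : chartAt (Cn n) x x ≠ 0 :=
  ne_zero_of_mem_target (chart_mem_atlas (Cn n) x) (mem_chart_target (Cn n) x)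

variable (γ) in
/-- A Hermitian metric on the Hopf manifold. -/
def hopfMetric : HermitianMetric (Cn n) (HopfManifold γ) where
  inner := γ.hopfInner
  conj_symm x v w := γ.invariantMetric_conj_symm (chartAt_self_ne_zero x) v w
  pos x v hv := γ.invariantMetric_pos (chartAt_self_ne_zero x) hv
  smooth e he v w := by
    refine ContDiffOn.congr (f := fun z => γ.invariantMetric z v w) (fun z hz => ?_)
      fun z hz => hopfInner_chartSymmDeriv he hz v w
    exact (γ.invariantMetric_contDiffAt (ne_zero_of_mem_target he hz) v w).contDiffWithinAt

theorem hopfMetric_logDet {e : OpenPartialHomeomorph (HopfManifold γ) (Cn n)}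
    (he : e ∈ atlas (Cn n) (HopfManifold γ)) {z : Cn n} (hz : z ∈ e.target) :
    γ.hopfMetric.logDet e z = γ.logDetMetric z := by
  have h : γ.hopfMetric.localMatrix e z = gramMatrix (γ.invariantMetric z) LinearMap.id := by
    ext j k
    exact hopfInner_chartSymmDeriv he hz _ _
  rw [HermitianMetric.logDet, h]
  rfl

variable (γ) in
/-- The Chern–Ricci form of the metric `hopfMetric`. -/
def hopfRicci : RoughForm (Cn n) (HopfManifold γ) 2 := fun x =>
  (-Complex.I) • (ddbar (fun w => (γ.logDetMetric w : ℂ)) (chartAt (Cn n) x x) :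
    (Cn n) [⋀^Fin 2]→L[ℝ] ℂ)

/-- Same change of chart as for the metric, now with `ddbar_logDetMetric_pullback` as the
invariance. -/
theorem localForm_hopfRicci {e : OpenPartialHomeomorph (HopfManifold γ) (Cn n)}
    (he : e ∈ atlas (Cn n) (HopfManifold γ)) {z : Cn n} (hz : z ∈ e.target) :
    localForm e γ.hopfRicci z = (-Complex.I) • ddbar (fun w => (γ.logDetMetric w : ℂ)) z := by
  obtain ⟨g, hg, hd⟩ := exists_chartSymmDeriv_eq he hz
  rw [← γ.ddbar_logDetMetric_pullback g (ne_zero_of_mem_target he hz), ← hg, ← hd]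
  rfl

theorem isChernRicciForm_hopfRicci : IsChernRicciForm γ.hopfMetric γ.hopfRicci := by
  intro e he z hz
  rw [localForm_hopfRicci he hz]
  congr 1
  refine ddbar_congr ?_
  filter_upwards [e.open_target.mem_nhds hz] with w hw
  rw [hopfMetric_logDet he hw]

theorem hopfRicci_mem : γ.hopfRicci ∈ closedOneOne (Cn n) (HopfManifold γ) := by
  refine ⟨fun e he => ?_, fun x v w => ?_, fun e he z hz => ?_⟩
  · refine ContDiffOn.congr (fun z hz => ?_) fun z hz => localForm_hopfRicci he hz
    exact ((ddbar_contDiffAt (γ.logDetMetric_contDiffAt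
      (ne_zero_of_mem_target he hz))).const_smul (-Complex.I)).contDiffWithinAt
  · exact congrArg ((-Complex.I) • ·)
      (ddbar_apply_I_smul (γ.logDetMetric_contDiffAt (chartAt_self_ne_zero x)) v w)
  · have hs := γ.logDetMetric_contDiffAt (ne_zero_of_mem_target he hz)
    have h1 : localForm e γ.hopfRicci =ᶠ[𝓝 z]
        (-Complex.I) • ddbar (fun w => (γ.logDetMetric w : ℂ)) := by
      filter_upwards [e.open_target.mem_nhds hz] with w hw
      exact localForm_hopfRicci he hw
    rw [h1.extDeriv_eq, extDeriv_const_smul_complex _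
      ((ddbar_contDiffAt hs).differentiableAt (by simp)), extDeriv_ddbar hs, smul_zero]

theorem firstBottChernClass_hopf : firstBottChernClass n (HopfManifold γ) =
    (Submodule.Quotient.mk ⟨γ.hopfRicci, hopfRicci_mem⟩ :
      BottChernOneOne (Cn n) (HopfManifold γ)) :=
  firstBottChernClass_eq (g := γ.hopfMetric) isChernRicciForm_hopfRicci

end HolomorphicContraction

/-! ### Boundedness of pluriharmonic functions near the puncture. -/

/-- The span of `z` has dimension at most one, so for `n ≥ 2` its orthogonal complement is nonzero.
-/
theorem Cn.exists_unit_orthogonal {n : ℕ} (hn : 2 ≤ n) (z : Cn n) :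
    ∃ a : Cn n, ‖a‖ = 1 ∧ inner ℂ z a = 0 := by
  have h1 : (Submodule.span ℂ {z})ᗮ ≠ ⊥ := by
    intro h
    rw [Submodule.orthogonal_eq_bot_iff] at h
    have h2 : Module.finrank ℂ (Submodule.span ℂ {z}) ≤ 1 :=
      (finrank_span_le_card {z}).trans (by simp)
    rw [h, finrank_top, finrank_euclideanSpace_fin] at h2
    exact absurd h2 (by lia)
  obtain ⟨b, hb, hb0⟩ := Submodule.exists_mem_ne_zero_of_ne_bot h1
  refine ⟨((‖b‖⁻¹ : ℝ) : ℂ) • b, ?_, ?_⟩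
  · rw [norm_smul, Complex.norm_real, norm_inv, norm_norm, inv_mul_cancel₀ (norm_ne_zero_iff.2 hb0)]
  · rw [inner_smul_right, Submodule.mem_orthogonal_singleton_iff_inner_right.1 hb, mul_zero]

/-- A pluriharmonic function on `ℂⁿ ∖ {0}`, where `n ≥ 2`, is bounded near the origin. -/
theorem exists_norm_le_of_pluriharmonic {n : ℕ} (hn : 2 ≤ n) {u : Cn n → ℂ}
    (hu : ∀ z ≠ 0, ContDiffAt ℝ ∞ u z) (h : ∀ z ≠ 0, ddbar u z = 0) :
    ∃ C : ℝ, ∀ z ≠ 0, ‖z‖ ≤ 1 → ‖u z‖ ≤ C := by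
  have hK : IsCompact {w : Cn n | 1 ≤ ‖w‖ ∧ ‖w‖ ≤ 2} :=
    (isCompact_closedBall (0 : Cn n) 2).of_isClosed_subset
      ((isClosed_le continuous_const continuous_norm).inter
        (isClosed_le continuous_norm continuous_const)) fun w hw => mem_closedBall_zero_iff.2 hw.2
  have hc : ContinuousOn u {w : Cn n | 1 ≤ ‖w‖ ∧ ‖w‖ ≤ 2} := fun w hw =>
    (hu w (norm_pos_iff.1 (one_pos.trans_le hw.1))).continuousAt.continuousWithinAt
  obtain ⟨C, hC⟩ := hK.exists_bound_of_continuousOn hc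
  refine ⟨C, fun z hz hz1 => ?_⟩
  obtain ⟨a, ha, hza⟩ := Cn.exists_unit_orthogonal hn z
  -- By Pythagoras the line avoids the origin, and for `‖z‖ ≤ 1` its unit circle has norms between
  -- `1` and `√2`, inside the shell where `C` was chosen.
  have h1 : ∀ t : ℂ, ‖z + t • a‖ * ‖z + t • a‖ = ‖z‖ * ‖z‖ + ‖t‖ * ‖t‖ := fun t => by
    have h2 : inner ℂ z (t • a) = 0 := by rw [inner_smul_right, hza, mul_zero]
    rw [norm_add_sq_eq_norm_sq_add_norm_sq_of_inner_eq_zero _ _ h2, norm_smul, ha, mul_one]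
  have h0 : ∀ t : ℂ, z + t • a ≠ 0 := fun t h2 => by
    have h3 := h1 t
    rw [h2, norm_zero, mul_zero] at h3
    nlinarith [norm_pos_iff.2 hz, norm_nonneg t]
  refine norm_le_of_pluriharmonic_line (fun t => hu _ (h0 t)) (fun t => h _ (h0 t)) fun t ht => ?_
  have h2 := h1 t
  rw [ht] at h2
  refine hC _ ⟨?_, ?_⟩ <;> nlinarith [norm_nonneg z, norm_nonneg (z + t • a)]

/-! ### Blow-up along orbits and the contradiction. -/

namespace HolomorphicContraction

variable {n : ℕ} (γ : HolomorphicContraction n)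

/-- The iterates of `γ`, as elements of the group. -/
def iter (k : ℕ) : γ.group := ⟨γ.perm ^ k, pow_mem (Subgroup.mem_zpowers _) k⟩

theorem extend_iter (k : ℕ) {z : Cn n} (hz : z ≠ 0) :
    γ.extend (γ.iter k) z = γ.toEquiv^[k] z := by
  rw [← γ.perm_pow_coe k ⟨z, hz⟩]
  exact (γ.coe_apply (γ.iter k) ⟨z, hz⟩).symm

theorem differentiable_iterate (k : ℕ) : Differentiable ℂ (γ.toEquiv^[k]) :=
  Differentiable.iterate (γ.holomorphic.differentiable (by simp)) k

/-- The iterates tend to `0` uniformly on the closed ball of radius `‖v‖` about `z`, which contains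
the disc `z + t v`, `|t| ≤ 1`; the Cauchy estimate on that disc controls the derivative along `v`.
-/
theorem tendsto_fderiv_iterate (z v : Cn n) :
    Filter.Tendsto (fun k : ℕ => fderiv ℂ (γ.toEquiv^[k]) z v) Filter.atTop (𝓝 0) := by
  rw [Metric.nhds_basis_closedBall.tendsto_right_iff]
  intro ε hε
  filter_upwards [γ.contracting _ (isCompact_closedBall z ‖v‖) _ (Metric.closedBall_mem_nhds 0 hε)]
    with k hk
  have hl : HasDerivAt (fun t : ℂ => z + t • v) v 0 := by
    simpa using ((hasDerivAt_id (0 : ℂ)).smul_const v).const_add z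
  have hl' : Differentiable ℂ fun t : ℂ => z + t • v := by fun_prop
  have h1 : HasDerivAt (fun t : ℂ => γ.toEquiv^[k] (z + t • v)) (fderiv ℂ (γ.toEquiv^[k]) z v) 0 := by
    have h2 := (γ.differentiable_iterate k (z + (0 : ℂ) • v)).hasFDerivAt.comp_hasDerivAt (0 : ℂ) hl
    rwa [zero_smul, add_zero] at h2
  have h3 := Complex.norm_deriv_le_of_forall_mem_sphere_norm_le (c := 0) (C := ε) one_pos
    ((γ.differentiable_iterate k).comp hl').diffContOnCl fun t ht => by
      refine mem_closedBall_zero_iff.1 (hk ?_)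
      rw [mem_closedBall_iff_norm, add_sub_cancel_left, norm_smul, mem_sphere_zero_iff_norm.1 ht,
        one_mul]
  rw [div_one] at h3
  rw [mem_closedBall_zero_iff, ← h1.deriv]
  exact h3

theorem tendsto_jacobian_iter (hn : n ≠ 0) {z : Cn n} (hz : z ≠ 0) :
    Filter.Tendsto (fun k : ℕ => γ.jacobian (γ.iter k) z) Filter.atTop (𝓝 0) := by
  -- The zero matrix has determinant `0` only in positive size; the empty determinant is `1`.
  have : Nonempty (Fin n) := Fin.pos_iff_nonempty.1 (Nat.pos_of_ne_zero hn)
  have h1 : Filter.Tendsto (fun k : ℕ => (Matrix.of fun i j =>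
      fderiv ℂ (γ.extend (γ.iter k)) z (EuclideanSpace.single j 1) i : Matrix (Fin n) (Fin n) ℂ))
      Filter.atTop (𝓝 0) := by
    refine tendsto_pi_nhds.2 fun i => tendsto_pi_nhds.2 fun j => ?_
    have h2 := ((EuclideanSpace.proj i : Cn n →L[ℂ] ℂ).continuous.tendsto 0).comp
      (γ.tendsto_fderiv_iterate z (EuclideanSpace.single j 1))
    refine h2.congr fun k => ?_
    have h3 : γ.extend (γ.iter k) =ᶠ[𝓝 z] γ.toEquiv^[k] := by
      filter_upwards [isOpen_compl_singleton.mem_nhds hz] with w hw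
      exact γ.extend_iter k hw
    rw [Matrix.of_apply, h3.fderiv_eq]
    rfl
  have h2 := (continuous_id.matrix_det.tendsto (0 : Matrix (Fin n) (Fin n) ℂ)).comp h1
  rw [id, Matrix.det_zero] at h2
  exact h2

/-- In the cocycle relation `z` is fixed and `log |J|² → -∞`, so the remaining term must tend to
`+∞`. -/
theorem tendsto_logDetMetric_iter (hn : n ≠ 0) {z : Cn n} (hz : z ≠ 0) :
    Filter.Tendsto (fun k : ℕ => γ.logDetMetric (γ.extend (γ.iter k) z)) Filter.atTop
      Filter.atTop := by
  have h1 : Filter.Tendsto (fun k : ℕ => Complex.normSq (γ.jacobian (γ.iter k) z)) Filter.atTop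
      (𝓝[>] 0) := by
    refine tendsto_nhdsWithin_iff.2 ⟨?_, .of_forall fun k =>
      Complex.normSq_pos.2 (γ.jacobian_ne_zero _ hz)⟩
    have h2 := (Complex.continuous_normSq.tendsto 0).comp (γ.tendsto_jacobian_iter hn hz)
    rwa [_root_.map_zero] at h2
  have h2 := Filter.tendsto_atTop_add_const_left Filter.atTop (γ.logDetMetric z)
    (Filter.tendsto_neg_atBot_atTop.comp (Real.tendsto_log_nhdsGT_zero.comp h1))
  refine h2.congr fun k => ?_
  rw [γ.logDetMetric_eq (γ.iter k) hz]
  simp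

variable {γ}

open Classical in
/-- The pull-back to `ℂⁿ ∖ {0}` of a function on the Hopf manifold, extended by `0`. -/
def lift (f : HopfManifold γ → ℂ) (z : Cn n) : ℂ :=
  if h : z ≠ 0 then f (γ.proj ⟨z, h⟩) else 0

theorem lift_apply (f : HopfManifold γ → ℂ) {z : Cn n} (hz : z ≠ 0) :
    lift f z = f (γ.proj ⟨z, hz⟩) := dif_pos hz

theorem lift_extend (f : HopfManifold γ → ℂ) (g : γ.group) {z : Cn n} (hz : z ≠ 0) :
    lift f (γ.extend g z) = lift f z := by
  rw [lift_apply f hz, lift_apply f (γ.extend_ne_zero g hz), ← γ.proj_smul g ⟨z, hz⟩]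
  exact congrArg (fun w => f (γ.proj w)) (Subtype.ext (γ.coe_apply g ⟨z, hz⟩).symm)

theorem exists_lift_eventuallyEq (f : HopfManifold γ → ℂ) {z : Cn n} (hz : z ≠ 0) :
    ∃ e ∈ atlas (Cn n) (HopfManifold γ), ∃ g : γ.group, γ.extend g z ∈ e.target ∧
      lift f =ᶠ[𝓝 z] (f ∘ e.symm) ∘ γ.extend g := by
  obtain ⟨g, -, h⟩ := exists_atlas_proj_eq (chart_mem_atlas (Cn n) (γ.proj ⟨z, hz⟩))
    (mem_chart_source (Cn n) (γ.proj ⟨z, hz⟩))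
  refine ⟨_, chart_mem_atlas (Cn n) (γ.proj ⟨z, hz⟩), g, h.self_of_nhds.choose_spec.1, ?_⟩
  filter_upwards [h] with w ⟨h1, _, h2⟩
  rw [lift_apply f h1, ← h2]
  rfl

theorem lift_contDiffAt {f : HopfManifold γ → ℂ} (hf : IsSmoothFun (E := Cn n) f) {z : Cn n}
    (hz : z ≠ 0) : ContDiffAt ℝ ∞ (lift f) z := by
  obtain ⟨e, he, g, hg, h⟩ := exists_lift_eventuallyEq f hz
  refine ContDiffAt.congr_of_eventuallyEq ?_ h
  exact ((hf e he).contDiffAt (e.open_target.mem_nhds hg)).comp z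
    (((γ.extend_contDiff g).of_le (m := ∞) le_top).restrict_scalars ℝ).contDiffAt

/-- A chart composed with the quotient map is locally a group element, so the local identity for `f`
pulls back to the cover and invariance of the Ricci form absorbs that element. -/
theorem ddbar_lift {f : HopfManifold γ → ℂ} (hf : IsSmoothFun (E := Cn n) f)
    (hf' : IsDdbarOf f γ.hopfRicci) {z : Cn n} (hz : z ≠ 0) :
    ddbar (lift f) z = (-Complex.I) • ddbar (fun w => (γ.logDetMetric w : ℂ)) z := by
  obtain ⟨e, he, g, hg, h⟩ := exists_lift_eventuallyEq f hz
  rw [ddbar_congr h, ddbar_comp ((hf e he).contDiffAt (e.open_target.mem_nhds hg))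
    (γ.extend_contDiff g).contDiffAt, ← hf' e he _ hg, localForm_hopfRicci he hg,
    ← γ.ddbar_logDetMetric_pullback g hz]
  rfl

theorem not_isDdbarOf_hopfRicci (hn : 2 ≤ n) {f : HopfManifold γ → ℂ}
    (hf : IsSmoothFun (E := Cn n) f) : ¬ IsDdbarOf f γ.hopfRicci := by
  intro hf'
  let u : Cn n → ℂ := fun w => (γ.logDetMetric w : ℂ)
  have hu : ∀ z ≠ 0, ContDiffAt ℝ ∞ u z := fun z hz => γ.logDetMetric_contDiffAt hz
  have hlift : ∀ z ≠ 0, ContDiffAt ℝ ∞ ((-Complex.I) • lift f) z :=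
    fun z hz => (lift_contDiffAt hf hz).const_smul (-Complex.I)
  -- The factor `-i` is chosen so that `(-i)(-i) = -1` cancels `∂∂̄u`.
  obtain ⟨C, hC⟩ := exists_norm_le_of_pluriharmonic hn (u := u + (-Complex.I) • lift f)
    (fun z hz => (hu z hz).add (hlift z hz)) fun z hz => by
      rw [ddbar_add (hu z hz) (hlift z hz), ddbar_const_smul _ (lift_contDiffAt hf hz),
        ddbar_lift hf hf' hz, smul_smul, neg_mul_neg,
        Complex.I_mul_I]
      ext v
      change ddbar u z v + -1 * ddbar u z v = 0
      ring
  have : NeZero n := ⟨by lia⟩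
  obtain ⟨z, hz⟩ : ∃ z : Cn n, z ≠ 0 := ⟨EuclideanSpace.single 0 1, by simp⟩
  have h1 := γ.contracting {z} isCompact_singleton _ (Metric.closedBall_mem_nhds 0 one_pos)
  -- The real part of `u - i f` is `u + Im f`, and `Im f` is constant on the orbit, so exceeding
  -- this threshold violates the bound `C`.
  have h2 := (γ.tendsto_logDetMetric_iter (by lia) hz).eventually_gt_atTop (C - (lift f z).im)
  obtain ⟨k, hk1, hk2⟩ := (h1.and h2).exists
  have h3 : ‖γ.extend (γ.iter k) z‖ ≤ 1 := by
    rw [γ.extend_iter k hz]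
    exact mem_closedBall_zero_iff.1 (hk1 rfl)
  have h4 := (Complex.re_le_norm _).trans (hC _ (γ.extend_ne_zero _ hz) h3)
  simp only [Pi.add_apply, Pi.smul_apply, lift_extend f _ hz, u, Complex.add_re, smul_eq_mul,
    Complex.ofReal_re, Complex.mul_re, Complex.neg_re, Complex.neg_im, Complex.I_re,
    Complex.I_im] at h4
  linarith

end HolomorphicContraction

end

theorem mainTheorem3 (n : ℕ) (hn : 2 ≤ n) (γ : HolomorphicContraction n) :
    firstBottChernClass n (HopfManifold γ) ≠ 0 := by
  rw [HolomorphicContraction.firstBottChernClass_hopf, Ne, Submodule.Quotient.mk_eq_zero]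
  rintro ⟨f, hf, hf'⟩
  exact HolomorphicContraction.not_isDdbarOf_hopfRicci hn hf hf'
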